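/- Let $W$ be a finite group acting by homeomorphisms on a locally compact Hausdorff space $X$, let $(\alpha_w b)(x)=b(w^{-1}x)$ for $b\in C_0(X)$, and let $\gamma:W\times W\to C(X,\mathbb T)$, $\gamma_x(v,w):=\gamma(v,w)(x)$, satisfy $\alpha_u(\gamma(v,w))\,\gamma(u,vw)=\gamma(u,v)\,\gamma(uv,w)$ and $\gamma(1,w)=\gamma(w,1)=1$. Let $E$ be a right Hilbert $C_0(X)$-module with an $(\alpha,\gamma)$-twisted action $U$ of $W$, i.e. invertible linear operators $U_w$ on $E$ with $U_w(\xi b)=U_w(\xi)\alpha_w(b)$, $\langle U_w\xi\,|\,U_w\eta\rangle=\alpha_w\langle\xi\,|\,\eta\rangle$ and $U_vU_w\xi=U_{vw}(\xi)\gamma(v,w)^*$. For $x\in X$ let $E_x=E\otimes_{C_0(X)}\mathbb C_x$, where $\mathbb C_x=\mathbb C$ with $C_0(X)$ acting by evaluation at $x$, put $\xi(x)=\xi\otimes 1$, and let $I_{w,x}:E_x\to E_{wx}$ be the unitary $\xi(x)\mapsto(U_w\xi)(wx)$. Assume that $E_x\neq 0$ for every $x\in X$. Let $W_x$ be the stabiliser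 of $x$, let $W'_x=\{w\in W_x : I_{w,x}\text{ is a scalar operator}\}$, and for $w\in W'_x$ let $\iota_{w,x}\in\mathbb T$ be the scalar with $I_{w,x}=\iota_{w,x}\,\mathrm{id}_{E_x}$. Assume that $E$ satisfies the completeness condition: for every $x\in X$, every irreducible unitary projective representation $\pi$ of $W_x$ with multiplier $\gamma_x$ (that is, $\pi(v)\pi(w)=\gamma_x(v,w)\pi(vw)$) such that $\pi(w')=\overline{\iota_{w',x}}\,\mathrm{id}$ for all $w'\in W'_x$ occurs in the contragredient (complex conjugate) of the $\overline{\gamma_x}$-representation $w\mapsto I_{w,x}$ of $W_x$ on $E_x$. Assume in addition that: 1. $\iota_{w',x}=1$ for all $x\in X$ and all $w'\in W'_x$; 2. $\gamma_x(v,w)=\gamma_y(v,w)$ for all $x,y\in X$ and all $v,w\in W$; 3. there are subgroups $W'$ and $R$ of $W$ such that $W=W'\rtimes R$ ($W'$ normal); 4. there is a point $x_0\in X$ with $W_{x_0}=W$; and 5. $W'_x=W_x\cap W'$ for all $x\in X$. Then the $C^*$-algebra $\operatorname{K}_{C_0(X)}(E)^W$ of those compact operators on the Hilbert module $E$ that commute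 with all $U_w$ is Morita equivalent to the twisted crossed product $C_0(X/W')\rtimes_\gamma R$. Here $R$ acts on the orbit space $X/W'$ by $r[x]=[rx]$, and $\gamma$ denotes the restriction to $R\times R$ of the given cocycle, which by (2) is a $\mathbb T$-valued function on $W\times W$. -/

import Mathlib

open scoped ZeroAtInfty ComplexOrder
open Filter Topology UniformSpace

set_option linter.unusedSectionVars false

noncomputable section

/-! ### Right Hilbert modules, adjointable and compact operators -/

/-- A right Hilbert module `E` over a (not necessarily unital) C⋆-algebra `B`: a complete normed
space with a right action `act ξ b = ξ · b` and a `B`-valued inner product `ip ξ η = ⟨ξ | η⟩`,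
linear in the second variable, with `‖ξ‖² = ‖⟨ξ | ξ⟩‖`.  An element of `B` is positive iff it is of
the form `b⋆ b`.  The laws of a `B`-module follow from the listed ones because the inner product is
nondegenerate; see `HilbertModule.act_add`, `add_act`, `smul_act`, `act_smul`, `act_mul`. -/
class HilbertModule (B E : Type*) [NonUnitalCStarAlgebra B] [NormedAddCommGroup E]
    [NormedSpace ℂ E] extends CompleteSpace E where
  ip : E → E → B
  act : E → B → E
  ip_add_right : ∀ ξ η ζ : E, ip ξ (η + ζ) = ip ξ η + ip ξ ζ
  ip_smul_right : ∀ (z : ℂ) (ξ η : E), ip ξ (z • η) = z • ip ξ η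
  ip_act_right : ∀ (ξ η : E) (b : B), ip ξ (act η b) = ip ξ η * b
  star_ip : ∀ ξ η : E, star (ip ξ η) = ip η ξ
  ip_self_nonneg : ∀ ξ : E, ∃ b : B, ip ξ ξ = star b * b
  norm_sq : ∀ ξ : E, ‖ξ‖ ^ 2 = ‖ip ξ ξ‖

namespace HilbertModule

section Basic

variable {B E : Type*} [NonUnitalCStarAlgebra B] [NormedAddCommGroup E] [NormedSpace ℂ E]
  [HilbertModule B E]

variable (B) in
theorem ip_zero_right (ξ : E) : ip (B := B) ξ 0 = 0 := by
  have h := ip_smul_right (B := B) 0 ξ (0 : E)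
  simpa using h

variable (B) in
theorem ip_neg_right (ξ η : E) : ip (B := B) ξ (-η) = -ip ξ η := by
  have h := ip_smul_right (B := B) (-1) ξ η
  simpa using h

variable (B) in
theorem ip_sub_right (ξ η ζ : E) : ip (B := B) ξ (η - ζ) = ip ξ η - ip ξ ζ := by
  rw [sub_eq_add_neg, ip_add_right, ip_neg_right, sub_eq_add_neg]

variable (B) in
theorem ip_add_left (ξ η ζ : E) : ip (B := B) (ξ + η) ζ = ip ξ ζ + ip η ζ := by
  rw [← star_ip, ip_add_right, star_add, star_ip, star_ip]

variable (B) in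
theorem ip_sub_left (ξ η ζ : E) : ip (B := B) (ξ - η) ζ = ip ξ ζ - ip η ζ := by
  rw [← star_ip, ip_sub_right, star_sub, star_ip, star_ip]

variable (B) in
theorem ip_smul_left (z : ℂ) (ξ η : E) : ip (B := B) (z • ξ) η = star z • ip ξ η := by
  rw [← star_ip, ip_smul_right, star_smul, star_ip]

theorem ip_act_left (ξ η : E) (b : B) : ip (act ξ b) η = star b * ip ξ η := by
  rw [← star_ip, ip_act_right, star_mul, star_ip]

variable (B) in
theorem ext_ip {ξ η : E} (h : ∀ ζ : E, ip (B := B) ζ ξ = ip ζ η) : ξ = η := by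
  have h1 : ip (B := B) (ξ - η) (ξ - η) = 0 := by
    rw [ip_sub_right, h, sub_self]
  have h2 := norm_sq (B := B) (ξ - η)
  rw [h1, norm_zero] at h2
  exact sub_eq_zero.mp (norm_eq_zero.mp (pow_eq_zero_iff (two_ne_zero)|>.mp h2))

theorem act_add (ξ : E) (b c : B) : act ξ (b + c) = act ξ b + act ξ c :=
  ext_ip B fun ζ => by simp only [ip_act_right, ip_add_right, mul_add]

theorem add_act (ξ η : E) (b : B) : act (ξ + η) b = act ξ b + act η b :=
  ext_ip B fun ζ => by simp only [ip_act_right, ip_add_right, add_mul]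

theorem act_smul (z : ℂ) (ξ : E) (b : B) : act ξ (z • b) = z • act ξ b :=
  ext_ip B fun ζ => by simp only [ip_act_right, ip_smul_right, mul_smul_comm]

theorem smul_act (z : ℂ) (ξ : E) (b : B) : act (z • ξ) b = z • act ξ b :=
  ext_ip B fun ζ => by simp only [ip_act_right, ip_smul_right, smul_mul_assoc]

theorem act_mul (ξ : E) (b c : B) : act ξ (b * c) = act (act ξ b) c :=
  ext_ip B fun ζ => by simp only [ip_act_right, mul_assoc]

variable (B) in
/-- The Cauchy–Schwarz inequality. -/
theorem norm_ip_le (ξ η : E) : ‖ip (B := B) ξ η‖ ≤ ‖ξ‖ * ‖η‖ := by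
  let _ : PartialOrder B := CStarAlgebra.spectralOrder B
  have _ : StarOrderedRing B := CStarAlgebra.spectralOrderedRing B
  rcases eq_or_ne ξ 0 with h | h
  · have h0 : ip (B := B) (0 : E) η = 0 := by rw [← star_ip, ip_zero_right, star_zero]
    simp [h, h0]
  set a : B := ip ξ η with ha
  have hsa : star a = ip η ξ := star_ip ξ η
  have hexp : ∀ c : ℂ, star c = c → ip (B := B) (act ξ a - c • η) (act ξ a - c • η)
      = star a * ip ξ ξ * a - c • (star a * a) - c • (star a * a) + c • (c • ip η η) := by
    intro c hc
    simp only [ip_sub_left, ip_sub_right, ip_act_left, ip_act_right, ip_smul_left,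
      ip_smul_right, ← hsa, ← ha, hc, sub_mul, smul_mul_assoc, mul_assoc, smul_sub]
    abel
  have hpos : (0 : B) ≤ star a * ip ξ ξ * a - (‖ξ‖ ^ 2) • (star a * a)
      - (‖ξ‖ ^ 2) • (star a * a) + (‖ξ‖ ^ 2) • ((‖ξ‖ ^ 2) • ip η η) := by
    obtain ⟨b, hb⟩ := ip_self_nonneg (B := B) (act ξ a - ((‖ξ‖ ^ 2 : ℝ) : ℂ) • η)
    have h2 := hexp ((‖ξ‖ ^ 2 : ℝ) : ℂ) (Complex.conj_ofReal _)
    rw [hb] at h2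
    simp only [Complex.coe_smul] at h2
    rw [← h2]
    exact star_mul_self_nonneg b
  have hconj : star a * ip ξ ξ * a ≤ (‖ξ‖ ^ 2) • (star a * a) := by
    rw [norm_sq (B := B) ξ]
    exact CStarAlgebra.star_left_conjugate_le_norm_smul (star_ip (B := B) ξ ξ)
  have h1 : (‖ξ‖ ^ 2) • (star a * a) ≤ (‖ξ‖ ^ 2) • ((‖ξ‖ ^ 2) • ip (B := B) η η) := by
    rw [← sub_nonneg] at hconj ⊢
    refine (add_nonneg hpos hconj).trans (le_of_eq ?_)
    abel
  rw [smul_le_smul_iff_of_pos_left (by positivity)] at h1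
  have h5 := CStarAlgebra.norm_le_norm_of_nonneg_of_le (star_mul_self_nonneg a) h1
  rw [CStarRing.norm_star_mul_self, norm_smul, ← norm_sq (B := B) η, Real.norm_of_nonneg
    (by positivity)] at h5
  refine (abs_le_of_sq_le_sq' ?_ (by positivity)).2
  nlinarith [h5]

variable (B) in
theorem continuous_ip_right (ξ : E) : Continuous fun η : E => ip (B := B) ξ η :=
  let L : E →ₗ[ℂ] B :=
    { toFun := fun η => ip (B := B) ξ η
      map_add' := ip_add_right ξ
      map_smul' := fun z η => ip_smul_right z ξ η }
  (L.mkContinuous ‖ξ‖ fun η => norm_ip_le B ξ η).continuous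

variable (B) in
theorem continuous_ip_left (η : E) : Continuous fun ξ : E => ip (B := B) ξ η := by
  have h : (fun ξ : E => ip (B := B) ξ η) = fun ξ : E => star (ip (B := B) η ξ) :=
    funext fun ξ => (star_ip η ξ).symm
  rw [h]
  exact (continuous_ip_right B η).star

variable (B) in
theorem norm_act_le (ξ : E) (b : B) : ‖act ξ b‖ ≤ ‖ξ‖ * ‖b‖ := by
  refine (abs_le_of_sq_le_sq' ?_ (by positivity)).2
  rw [norm_sq (B := B) (act ξ b), ip_act_right, ip_act_left, mul_pow, norm_sq (B := B) ξ]
  calc ‖star b * ip ξ ξ * b‖ ≤ ‖star b‖ * ‖ip (B := B) ξ ξ‖ * ‖b‖ :=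
        (norm_mul_le _ _).trans (by gcongr; exact norm_mul_le _ _)
    _ = ‖ip (B := B) ξ ξ‖ * ‖b‖ ^ 2 := by rw [norm_star]; ring

variable (B) in
/-- The operator `ζ ↦ ξ · ⟨η | ζ⟩` as a bounded linear map. -/
def ketbraCLM (ξ η : E) : E →L[ℂ] E :=
  let L : E →ₗ[ℂ] E :=
    { toFun := fun ζ => act ξ (ip (B := B) η ζ)
      map_add' := fun ζ θ => by rw [ip_add_right, act_add]
      map_smul' := fun z ζ => by rw [ip_smul_right, act_smul]; rfl }
  L.mkContinuous (‖ξ‖ * ‖η‖) fun ζ => (norm_act_le B _ _).trans (by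
    rw [mul_assoc]; gcongr; exact norm_ip_le B η ζ)

theorem ketbraCLM_apply (ξ η ζ : E) : ketbraCLM B ξ η ζ = act ξ (ip (B := B) η ζ) := rfl

end Basic

section Operators

variable (B E : Type*) [NonUnitalCStarAlgebra B] [NormedAddCommGroup E] [NormedSpace ℂ E]
  [HilbertModule B E]

/-- The subalgebra of those bounded operators on the Hilbert `B`-module `E` that have an adjoint. -/
def adjointableSubalgebra : Subalgebra ℂ (E →L[ℂ] E) where
  carrier := {T | ∃ S : E →L[ℂ] E, ∀ ξ η : E, ip (B := B) (T ξ) η = ip ξ (S η)}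
  mul_mem' := by
    rintro T T' ⟨S, hS⟩ ⟨S', hS'⟩
    exact ⟨S' * S, fun ξ η => by
      simp only [mul_apply_eq_comp, hS, hS']⟩
  add_mem' := by
    rintro T T' ⟨S, hS⟩ ⟨S', hS'⟩
    exact ⟨S + S', fun ξ η => by
      simp only [_root_.add_apply, ip_add_left, ip_add_right, hS, hS']⟩
  algebraMap_mem' z :=
    ⟨algebraMap ℂ _ (star z), fun ξ η => by
      simp only [ContinuousLinearMap.algebraMap_apply, ip_smul_left, ip_smul_right]⟩

/-- The C⋆-algebra of adjointable operators on the Hilbert `B`-module `E`, with the operator norm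
and the adjoint as involution. -/
def Adjointable : Type _ := adjointableSubalgebra B E

namespace Adjointable

instance : NormedRing (Adjointable B E) := inferInstanceAs (NormedRing (adjointableSubalgebra B E))

instance : NormedAlgebra ℂ (Adjointable B E) :=
  inferInstanceAs (NormedAlgebra ℂ (adjointableSubalgebra B E))

variable {B E}

/-- The underlying bounded operator. -/
def toCLM (T : Adjointable B E) : E →L[ℂ] E := T.1

/-- An operator with a given adjoint. -/
def mk (T S : E →L[ℂ] E) (h : ∀ ξ η : E, ip (B := B) (T ξ) η = ip ξ (S η)) : Adjointable B E :=
  ⟨T, S, h⟩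

instance : CoeFun (Adjointable B E) fun _ => E → E := ⟨fun T => T.toCLM⟩

theorem toCLM_mk (T S : E →L[ℂ] E) (h : ∀ ξ η : E, ip (B := B) (T ξ) η = ip ξ (S η)) :
    (mk T S h).toCLM = T := rfl

theorem mk_apply (T S : E →L[ℂ] E) (h : ∀ ξ η : E, ip (B := B) (T ξ) η = ip ξ (S η)) (ξ : E) :
    mk T S h ξ = T ξ := rfl

theorem mul_apply (S T : Adjointable B E) (ξ : E) : (S * T) ξ = S (T ξ) := rfl

theorem one_apply (ξ : E) : (1 : Adjointable B E) ξ = ξ := rfl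

theorem zero_apply (ξ : E) : (0 : Adjointable B E) ξ = 0 := rfl

theorem add_apply (S T : Adjointable B E) (ξ : E) : (S + T) ξ = S ξ + T ξ := rfl

theorem smul_apply (z : ℂ) (T : Adjointable B E) (ξ : E) : (z • T) ξ = z • T ξ := rfl

theorem norm_def (T : Adjointable B E) : ‖T‖ = ‖T.toCLM‖ := rfl

theorem isometry_toCLM : Isometry (toCLM : Adjointable B E → E →L[ℂ] E) := isometry_subtype_coe

theorem ext {S T : Adjointable B E} (h : ∀ ξ : E, S ξ = T ξ) : S = T :=
  Subtype.ext (ContinuousLinearMap.ext h)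

theorem exists_adjoint (T : Adjointable B E) :
    ∃ S : E →L[ℂ] E, ∀ ξ η : E, ip (B := B) (T ξ) η = ip ξ (S η) := T.2

instance : Star (Adjointable B E) :=
  ⟨fun T => mk T.exists_adjoint.choose T.toCLM fun ξ η => by
    rw [← star_ip, ← T.exists_adjoint.choose_spec, star_ip]⟩

theorem ip_apply_left (T : Adjointable B E) (ξ η : E) :
    ip (B := B) (T ξ) η = ip ξ (star T η) :=
  T.exists_adjoint.choose_spec ξ η

theorem ip_apply_right (T : Adjointable B E) (ξ η : E) :
    ip (B := B) ξ (T η) = ip (star T ξ) η := by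
  rw [← star_ip, ip_apply_left, star_ip]

theorem eq_star_of_ip {T S : Adjointable B E}
    (h : ∀ ξ η : E, ip (B := B) (T ξ) η = ip ξ (S η)) : S = star T :=
  ext fun η => ext_ip B fun ζ => by rw [← h, ip_apply_left]

instance : StarRing (Adjointable B E) where
  star_involutive T := (eq_star_of_ip fun ξ η => (ip_apply_right T ξ η).symm).symm
  star_mul S T := (eq_star_of_ip fun ξ η => by
    simp only [mul_apply, ip_apply_left]).symm
  star_add S T := (eq_star_of_ip fun ξ η => by
    simp only [add_apply, ip_add_left, ip_add_right, ip_apply_left]).symm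

instance : StarModule ℂ (Adjointable B E) where
  star_smul z T := (eq_star_of_ip fun ξ η => by
    simp only [smul_apply, ip_smul_left, ip_smul_right, ip_apply_left]).symm

instance : CStarRing (Adjointable B E) where
  norm_mul_self_le T := by
    have h : ‖T.toCLM‖ ≤ √‖star T * T‖ := by
      refine ContinuousLinearMap.opNorm_le_bound _ (Real.sqrt_nonneg _) fun ξ => ?_
      refine (abs_le_of_sq_le_sq' ?_ (by positivity)).2
      have h2 : ‖(star T * T) ξ‖ ≤ ‖star T * T‖ * ‖ξ‖ := (star T * T).toCLM.le_opNorm ξ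
      rw [mul_pow, Real.sq_sqrt (norm_nonneg _), norm_sq (B := B) (T ξ), ip_apply_left]
      refine (norm_ip_le B _ _).trans ?_
      calc ‖ξ‖ * ‖star T (T ξ)‖ ≤ ‖ξ‖ * (‖star T * T‖ * ‖ξ‖) := by gcongr; exact h2
        _ = ‖star T * T‖ * ‖ξ‖ ^ 2 := by ring
    rw [← norm_def] at h
    calc ‖T‖ * ‖T‖ ≤ √‖star T * T‖ * √‖star T * T‖ := by gcongr
      _ = ‖star T * T‖ := Real.mul_self_sqrt (norm_nonneg _)

instance : CompleteSpace (Adjointable B E) := by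
  have : CompleteSpace E := HilbertModule.toCompleteSpace B
  refine Metric.complete_of_cauchySeq_tendsto fun u hu => ?_
  have hu2 : CauchySeq fun n => star (u n) := by
    rw [Metric.cauchySeq_iff] at hu ⊢
    intro ε hε
    obtain ⟨N, hN⟩ := hu ε hε
    refine ⟨N, fun m hm n hn => ?_⟩
    rw [dist_eq_norm, ← star_sub, norm_star, ← dist_eq_norm]
    exact hN m hm n hn
  have hv : UniformContinuous (toCLM : Adjointable B E → _) := isometry_toCLM.uniformContinuous
  obtain ⟨T, hT⟩ := cauchySeq_tendsto_of_complete (hv.comp_cauchySeq hu)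
  obtain ⟨S, hS⟩ := cauchySeq_tendsto_of_complete (hv.comp_cauchySeq hu2)
  refine ⟨mk T S fun ξ η => ?_, isometry_toCLM.isEmbedding.tendsto_nhds_iff.mpr hT⟩
  have hT' : Tendsto (fun n => u n ξ) atTop (𝓝 (T ξ)) :=
    ((ContinuousLinearMap.apply ℂ E ξ).continuous.tendsto T).comp hT
  have hS' : Tendsto (fun n => star (u n) η) atTop (𝓝 (S η)) :=
    ((ContinuousLinearMap.apply ℂ E η).continuous.tendsto S).comp hS
  refine tendsto_nhds_unique (f := fun n => ip (B := B) (u n ξ) η) (l := atTop)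
    (((continuous_ip_left B η).tendsto _).comp hT') ?_
  simp only [ip_apply_left]
  exact ((continuous_ip_right B ξ).tendsto _).comp hS'

instance : CStarAlgebra (Adjointable B E) where

end Adjointable

variable {B E}

variable (B) in
/-- The rank-one operator `|ξ⟩⟨η| : ζ ↦ ξ · ⟨η | ζ⟩`, whose adjoint is `|η⟩⟨ξ|`. -/
def ketbra (ξ η : E) : Adjointable B E :=
  Adjointable.mk (ketbraCLM B ξ η) (ketbraCLM B η ξ) fun ζ θ => by
    simp only [ketbraCLM_apply, ip_act_left, ip_act_right, star_ip]

theorem ketbra_apply (ξ η ζ : E) : ketbra B ξ η ζ = act ξ (ip (B := B) η ζ) := rfl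

theorem star_ketbra (ξ η : E) : star (ketbra B ξ η) = ketbra B η ξ :=
  (Adjointable.eq_star_of_ip fun ζ θ => by
    simp only [ketbra_apply, ip_act_left, ip_act_right, star_ip]).symm

theorem mul_ketbra (T : Adjointable B E) (ξ η : E) :
    T * ketbra B ξ η = ketbra B (T ξ) η :=
  Adjointable.ext fun ζ => ext_ip B fun θ => by
    simp only [Adjointable.mul_apply, ketbra_apply, ip_act_right, Adjointable.ip_apply_right]

variable (B E) in
/-- The C⋆-algebra `K_B(E)` of compact operators: the norm closure of the linear span of the
rank-one operators. -/
def compacts : NonUnitalStarSubalgebra ℂ (Adjointable B E) where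
  __ := (Submodule.span ℂ {T : Adjointable B E | ∃ ξ η : E, T = ketbra B ξ η}).topologicalClosure
  mul_mem' {S T} hS hT := by
    have h1 : ∀ T ∈ Submodule.span ℂ {T : Adjointable B E | ∃ ξ η : E, T = ketbra B ξ η},
        S * T ∈ Submodule.span ℂ {T : Adjointable B E | ∃ ξ η : E, T = ketbra B ξ η} := by
      intro T hT
      induction hT using Submodule.span_induction with
      | mem x h =>
        obtain ⟨ξ, η, rfl⟩ := h
        exact Submodule.subset_span ⟨S ξ, η, mul_ketbra S ξ η⟩
      | zero => rw [mul_zero]; exact Submodule.zero_mem _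
      | add x y _ _ hx hy => rw [mul_add]; exact Submodule.add_mem _ hx hy
      | smul z x _ hx => rw [mul_smul_comm]; exact Submodule.smul_mem _ z hx
    exact map_mem_closure (continuous_const_mul S) hT h1
  star_mem' {T} hT := by
    have h1 : ∀ T ∈ Submodule.span ℂ {T : Adjointable B E | ∃ ξ η : E, T = ketbra B ξ η},
        star T ∈ Submodule.span ℂ {T : Adjointable B E | ∃ ξ η : E, T = ketbra B ξ η} := by
      intro T hT
      induction hT using Submodule.span_induction with
      | mem x h =>
        obtain ⟨ξ, η, rfl⟩ := h
        exact Submodule.subset_span ⟨η, ξ, star_ketbra ξ η⟩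
      | zero => rw [star_zero]; exact Submodule.zero_mem _
      | add x y _ _ hx hy => rw [star_add]; exact Submodule.add_mem _ hx hy
      | smul z x _ hx => rw [star_smul]; exact Submodule.smul_mem _ _ hx
    exact map_mem_closure continuous_star hT h1

instance : IsClosed (compacts B E : Set (Adjointable B E)) := isClosed_closure

variable (B E) in
/-- `E` is full: the inner products `⟨ξ | η⟩` span a dense subspace of `B`. -/
def IsFull : Prop :=
  Dense (Submodule.span ℂ {b : B | ∃ ξ η : E, b = ip ξ η} : Set B)

end Operators

end HilbertModule

/-- (Strong) Morita equivalence of C⋆-algebras: `A` is isomorphic to the algebra of compact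
operators on a full right Hilbert `B`-module. -/
def MoritaEquivalent.{u, v} (A : Type u) (B : Type v) [NonUnitalCStarAlgebra A]
    [NonUnitalCStarAlgebra B] : Prop :=
  ∃ (F : Type (max u v)) (_ : NormedAddCommGroup F) (_ : NormedSpace ℂ F) (_ : HilbertModule B F),
    HilbertModule.IsFull B F ∧ Nonempty (A ≃⋆ₐ[ℂ] HilbertModule.compacts B F)

/-! ### Twisted actions and twisted crossed products -/

section CrossedProducts

/-- A normalised `2`-cocycle `γ : W × W → C(Y, 𝕋)` for an action of `W` on `Y`; with
`(α_w b)(y) = b(w⁻¹ y)`, the identity is `α_u(γ(v,w)) γ(u,vw) = γ(u,v) γ(uv,w)`. Together with the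
action `α` it is a twisted action of `W` on `C₀(Y)`. -/
structure TwoCocycle (W Y : Type*) [Group W] [TopologicalSpace Y] [MulAction W Y] where
  toFun : W → W → C(Y, Circle)
  cocycle : ∀ (u v w : W) (y : Y),
    toFun v w (u⁻¹ • y) * toFun u (v * w) y = toFun u v y * toFun (u * v) w y
  one_left : ∀ w : W, toFun 1 w = 1
  one_right : ∀ w : W, toFun w 1 = 1

namespace TwoCocycle

variable {W Y : Type*} [Group W] [TopologicalSpace Y] [MulAction W Y]

/-- The value `γ_y(v, w) ∈ 𝕋` of `γ(v, w)` at the point `y`. -/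
def val (γ : TwoCocycle W Y) (y : Y) (v w : W) : Circle := γ.toFun v w y

/-- If `γ_x(v, w)` does not depend on `x` and `R` is a subgroup of `W` acting on a space `Z`, then
`γ` restricts to the cocycle on `R` with constant values `γ(r, s) ∈ 𝕋`; the point `x₀` is only used
to read off these values. -/
def restrictConst (γ : TwoCocycle W Y) (hγ : ∀ (x y : Y) (v w : W), γ.val x v w = γ.val y v w)
    (x₀ : Y) (R : Subgroup W) (Z : Type*) [TopologicalSpace Z] [MulAction R Z] :
    TwoCocycle R Z where
  toFun r s := ContinuousMap.const Z (γ.val x₀ r s)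
  cocycle u v w _ := by
    have h := γ.cocycle (u : W) v w x₀
    have h' := hγ ((u : W)⁻¹ • x₀) x₀ v w
    simp only [val] at h'
    rw [h'] at h
    exact h
  one_left w := by ext; simp [val, γ.one_left]
  one_right w := by ext; simp [val, γ.one_right]

end TwoCocycle

variable {W Y : Type*} [Group W] [TopologicalSpace Y] [MulAction W Y] [ContinuousConstSMul W Y]

/-- The automorphism `α_w` of `C₀(Y)`: `(α_w b)(y) = b(w⁻¹ y)`. -/
def alphaC0 (w : W) (b : C₀(Y, ℂ)) : C₀(Y, ℂ) where
  toFun y := b (w⁻¹ • y)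
  continuous_toFun := (map_continuous b).comp (continuous_const_smul w⁻¹)
  zero_at_infty' := (zero_at_infty b).comp (Homeomorph.smul w⁻¹).isClosedEmbedding.tendsto_cocompact

theorem alphaC0_apply (w : W) (b : C₀(Y, ℂ)) (y : Y) : alphaC0 w b y = b (w⁻¹ • y) := rfl

theorem norm_alphaC0_le (w : W) (b : C₀(Y, ℂ)) : ‖alphaC0 w b‖ ≤ ‖b‖ :=
  (BoundedContinuousFunction.norm_le (f := (alphaC0 w b).toBCF) (norm_nonneg b)).mpr fun y =>
    b.toBCF.norm_coe_le_norm (w⁻¹ • y)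

theorem norm_alphaC0 (w : W) (b : C₀(Y, ℂ)) : ‖alphaC0 w b‖ = ‖b‖ := by
  refine le_antisymm (norm_alphaC0_le w b) ?_
  have h : b = alphaC0 w⁻¹ (alphaC0 w b) := ZeroAtInftyContinuousMap.ext fun y => by
    simp only [alphaC0_apply, inv_inv, inv_smul_smul]
  calc ‖b‖ = ‖alphaC0 w⁻¹ (alphaC0 w b)‖ := by rw [← h]
    _ ≤ ‖alphaC0 w b‖ := norm_alphaC0_le _ _

/-- The product of the unitary multiplier `m ∈ C(Y, 𝕋)` with `b ∈ C₀(Y)`. -/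
def circleMul {Y : Type*} [TopologicalSpace Y] (m : C(Y, Circle)) (b : C₀(Y, ℂ)) : C₀(Y, ℂ) where
  toFun y := (m y : ℂ) * b y
  continuous_toFun := (continuous_subtype_val.comp m.continuous).mul (map_continuous b)
  zero_at_infty' := by
    rw [tendsto_zero_iff_norm_tendsto_zero]
    simpa only [norm_mul, Circle.norm_coe, one_mul] using
      (tendsto_zero_iff_norm_tendsto_zero.mp (zero_at_infty b))

theorem circleMul_apply {Y : Type*} [TopologicalSpace Y] (m : C(Y, Circle)) (b : C₀(Y, ℂ)) (y : Y) :
    circleMul m b y = (m y : ℂ) * b y := rfl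

attribute [local instance] Fintype.ofFinite

/-- The C⋆-algebra `C₀(Y, M_W(ℂ))`, with the supremum of the operator norms on `ℓ²(W)` as norm; it
acts faithfully on `ℓ²(W) ⊗ ℓ²(Y)`. -/
def MatrixFunctions (W Y : Type*) [Finite W] [TopologicalSpace Y] : Type _ :=
  C₀(Y, CStarMatrix W W ℂ)

instance (W Y : Type*) [Finite W] [TopologicalSpace Y] :
    NonUnitalCStarAlgebra (MatrixFunctions W Y) :=
  inferInstanceAs (NonUnitalCStarAlgebra C₀(Y, CStarMatrix W W ℂ))

/-- The `(u, v)` entry at `y` of a matrix-valued function. -/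
def MatrixFunctions.entry {W Y : Type*} [Finite W] [TopologicalSpace Y] (F : MatrixFunctions W Y)
    (y : Y) (u v : W) : ℂ := ZeroAtInftyContinuousMap.toContinuousMap F y u v

/-- The twisted crossed product `C₀(Y) ⋊_γ W` of `C₀(Y)` by the finite group `W`. The function
`f : W → C₀(Y)` stands for the formal sum `∑_w f(w) w`. -/
def CrossedProduct (_γ : TwoCocycle W Y) : Type _ := W → C₀(Y, ℂ)

namespace CrossedProduct

variable {γ : TwoCocycle W Y}

instance : AddCommGroup (CrossedProduct γ) := inferInstanceAs (AddCommGroup (W → C₀(Y, ℂ)))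

instance : Module ℂ (CrossedProduct γ) := inferInstanceAs (Module ℂ (W → C₀(Y, ℂ)))

/-- The coefficient `f(w) ∈ C₀(Y)` of `w` in `f = ∑_w f(w) w`. -/
def coeff (f : CrossedProduct γ) (w : W) : C₀(Y, ℂ) := f w

/-- The formal sum with the given coefficients. -/
def ofCoeff (γ : TwoCocycle W Y) (f : W → C₀(Y, ℂ)) : CrossedProduct γ := f

theorem ext_coeff {f g : CrossedProduct γ} (h : ∀ w y, f.coeff w y = g.coeff w y) : f = g :=
  funext fun w => ZeroAtInftyContinuousMap.ext (h w)

theorem coeff_ofCoeff (f : W → C₀(Y, ℂ)) (w : W) : (ofCoeff γ f).coeff w = f w := rfl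

theorem coeff_add (f g : CrossedProduct γ) (w : W) : (f + g).coeff w = f.coeff w + g.coeff w := rfl

theorem coeff_smul (z : ℂ) (f : CrossedProduct γ) (w : W) : (z • f).coeff w = z • f.coeff w := rfl

/-- The involution, given by `(b w)⋆ = γ(w⁻¹, w)⋆ α_{w⁻¹}(b⋆) w⁻¹`. -/
instance : Star (CrossedProduct γ) :=
  ⟨fun f => ofCoeff γ fun u => circleMul (γ.toFun u u⁻¹)⁻¹ (alphaC0 u (star (f.coeff u⁻¹)))⟩

variable [Finite W]

/-- The product, given by `b₁ w₁ · b₂ w₂ = b₁ α_{w₁}(b₂) γ(w₁, w₂) w₁ w₂`. -/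
instance : Mul (CrossedProduct γ) :=
  ⟨fun f g => ofCoeff γ fun u =>
    ∑ w : W, f.coeff w * circleMul (γ.toFun w (w⁻¹ * u)) (alphaC0 w (g.coeff (w⁻¹ * u)))⟩

theorem coeff_mul_apply (f g : CrossedProduct γ) (u : W) (y : Y) :
    (f * g).coeff u y =
      ∑ w : W, f.coeff w y * ((γ.val y w (w⁻¹ * u) : ℂ) * g.coeff (w⁻¹ * u) (w⁻¹ • y)) := by
  have h : ∀ (s : Finset W) (F : W → C₀(Y, ℂ)), (∑ w ∈ s, F w) y = ∑ w ∈ s, F w y := by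
    intro s F
    classical
    induction s using Finset.induction_on with
    | empty => simp
    | insert a s ha ih => simp [Finset.sum_insert ha, ih]
  exact h _ _

theorem coeff_star_apply (f : CrossedProduct γ) (u : W) (y : Y) :
    (star f).coeff u y = star (γ.val y u u⁻¹ : ℂ) * star (f.coeff u⁻¹ (u⁻¹ • y)) := by
  change ((((γ.toFun u u⁻¹)⁻¹ : C(Y, Circle)) y : Circle) : ℂ) * _ = _
  rw [ContinuousMap.inv_apply, Circle.coe_inv_eq_conj]
  rfl

/-- The regular representation. At the point `y ∈ Y` it is the matrix, over `W × W`, of the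
operator on `ℓ²(W)` given by `b w · δ_v = (b γ(w, v))(w v y) δ_{w v}`.  Putting all `y` together,
this is the operator `b w (δ_v ⊗ h) = δ_{w v} ⊗ α_{w v}⁻¹(b γ(w, v)) h` on `ℓ²(W) ⊗ ℓ²(Y)`, where
`C₀(Y)` acts faithfully on `ℓ²(Y)` by multiplication. -/
def regular (f : CrossedProduct γ) : MatrixFunctions W Y where
  toFun y := CStarMatrix.ofMatrix fun u v =>
    f.coeff (u * v⁻¹) (u • y) * (γ.val (u • y) (u * v⁻¹) v : ℂ)
  continuous_toFun := by
    refine continuous_pi fun u => continuous_pi fun v => ?_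
    exact ((map_continuous (f.coeff (u * v⁻¹))).comp (continuous_const_smul u)).mul
      (continuous_subtype_val.comp
        ((γ.toFun (u * v⁻¹) v).continuous.comp (continuous_const_smul u)))
  zero_at_infty' := by
    refine tendsto_pi_nhds.mpr fun u => tendsto_pi_nhds.mpr fun v => ?_
    have h : Tendsto (fun y => f.coeff (u * v⁻¹) (u • y)) (cocompact Y) (𝓝 0) :=
      (zero_at_infty (f.coeff (u * v⁻¹))).comp
        (Homeomorph.smul u).isClosedEmbedding.tendsto_cocompact
    change Tendsto (fun y => f.coeff (u * v⁻¹) (u • y) * (γ.val (u • y) (u * v⁻¹) v : ℂ))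
      (cocompact Y) (𝓝 0)
    rw [tendsto_zero_iff_norm_tendsto_zero] at h ⊢
    simpa only [norm_mul, Circle.norm_coe, mul_one] using h

theorem regular_apply (f : CrossedProduct γ) (y : Y) (u v : W) :
    (regular f).entry y u v = f.coeff (u * v⁻¹) (u • y) * (γ.val (u • y) (u * v⁻¹) v : ℂ) := rfl

theorem regular_ext {F G : MatrixFunctions W Y}
    (h : ∀ y u v, F.entry y u v = G.entry y u v) : F = G :=
  ZeroAtInftyContinuousMap.ext fun y => CStarMatrix.ext fun u v => h y u v

theorem regular_one_right (f : CrossedProduct γ) (w : W) (y : Y) :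
    (regular f).entry (w⁻¹ • y) w 1 = f.coeff w y := by
  simp [regular_apply, TwoCocycle.val, γ.one_right]

theorem regular_injective : Function.Injective (regular : CrossedProduct γ → MatrixFunctions W Y) := by
  intro f g h
  refine ext_coeff fun w y => ?_
  rw [← regular_one_right, h, regular_one_right]

theorem regular_add (f g : CrossedProduct γ) : regular (f + g) = regular f + regular g :=
  regular_ext fun y u v => by
    rw [regular_apply, coeff_add]
    exact add_mul _ _ _

theorem regular_smul (z : ℂ) (f : CrossedProduct γ) : regular (z • f) = z • regular f :=
  regular_ext fun y u v => by
    rw [regular_apply, coeff_smul]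
    exact mul_assoc _ _ _

theorem regular_mul (f g : CrossedProduct γ) : regular (f * g) = regular f * regular g :=
  regular_ext fun y u v => by
    have h : (regular f * regular g).entry y u v =
        ∑ x : W, (regular f).entry y u x * (regular g).entry y x v := rfl
    rw [h, regular_apply, coeff_mul_apply, Finset.sum_mul]
    refine Fintype.sum_equiv ((Equiv.inv W).trans (Equiv.mulRight u)) _ _ fun w => ?_
    obtain ⟨x, rfl⟩ : ∃ x, u = w * x := ⟨w⁻¹ * u, by group⟩
    have hx : ((Equiv.inv W).trans (Equiv.mulRight (w * x))) w = x := by simp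
    rw [hx, regular_apply, regular_apply]
    have hc := congrArg (fun c : Circle => (c : ℂ)) (γ.cocycle w (x * v⁻¹) v ((w * x) • y))
    simp only [Circle.coe_mul, inv_mul_cancel_right, smul_smul, inv_mul_cancel_left] at hc
    have e1 : w * x * v⁻¹ = w * (x * v⁻¹) := mul_assoc _ _ _
    have e2 : w * x * x⁻¹ = w := by group
    have e3 : w⁻¹ * (w * (x * v⁻¹)) = x * v⁻¹ := by group
    have e4 : w⁻¹ • (w * x) • y = x • y := by rw [smul_smul, inv_mul_cancel_left]
    simp only [e1, e2, e3, e4, TwoCocycle.val]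
    linear_combination (-(f.coeff w ((w * x) • y) * g.coeff (x * v⁻¹) (x • y))) * hc

theorem regular_star (f : CrossedProduct γ) : regular (star f) = star (regular f) :=
  regular_ext fun y u v => by
    have h : (star (regular f)).entry y u v = star ((regular f).entry y v u) := rfl
    rw [h, regular_apply, regular_apply, coeff_star_apply]
    obtain ⟨w, rfl⟩ : ∃ w, u = w * v := ⟨u * v⁻¹, by group⟩
    have hc := congrArg (fun c : Circle => (c : ℂ)) (γ.cocycle w w⁻¹ (w * v) ((w * v) • y))
    have e1 : w * v * v⁻¹ = w := by group
    have e2 : v * (w * v)⁻¹ = w⁻¹ := by group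
    have e3 : w⁻¹ • (w * v) • y = v • y := by rw [smul_smul, inv_mul_cancel_left]
    have e4 : w⁻¹ * (w * v) = v := by group
    simp only [Circle.coe_mul, e3, e4, mul_inv_cancel, γ.one_left, ContinuousMap.one_apply, mul_one] at hc
    simp only [e1, e2, e3, TwoCocycle.val, star_mul', ← hc]
    have hn : (starRingEnd ℂ) (γ.toFun w v ((w * v) • y) : ℂ) * (γ.toFun w v ((w * v) • y) : ℂ)
        = 1 := by
      rw [← Complex.normSq_eq_conj_mul_self, Circle.normSq_coe, Complex.ofReal_one]
    simp only [RCLike.star_def] at hn ⊢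
    linear_combination ((starRingEnd ℂ) (γ.toFun w⁻¹ (w * v) (v • y) : ℂ) *
      (starRingEnd ℂ) (f.coeff w⁻¹ (v • y))) * hn

instance : NonUnitalRing (CrossedProduct γ) where
  __ : AddCommGroup (CrossedProduct γ) := inferInstance
  left_distrib f g h := regular_injective <| by
    rw [regular_mul, regular_add, regular_add, regular_mul, regular_mul]
    exact mul_add (regular f) _ _
  right_distrib f g h := regular_injective <| by
    rw [regular_mul, regular_add, regular_add, regular_mul, regular_mul]
    exact add_mul (regular f) _ _
  mul_assoc f g h := regular_injective <| by
    rw [regular_mul, regular_mul, regular_mul, regular_mul]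
    exact mul_assoc (regular f) _ _
  zero_mul f := ext_coeff fun w y => by
    rw [coeff_mul_apply]
    exact Finset.sum_eq_zero fun _ _ => zero_mul _
  mul_zero f := ext_coeff fun w y => by
    rw [coeff_mul_apply]
    refine Finset.sum_eq_zero fun x _ => ?_
    have h : (0 : CrossedProduct γ).coeff (x⁻¹ * w) (x⁻¹ • y) = 0 := rfl
    rw [h, mul_zero, mul_zero]

instance : StarRing (CrossedProduct γ) where
  star_involutive f := regular_injective <| by
    rw [regular_star, regular_star]
    exact star_star (regular f)
  star_mul f g := regular_injective <| by
    rw [regular_star, regular_mul, regular_mul, regular_star, regular_star]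
    exact star_mul (regular f) (regular g)
  star_add f g := regular_injective <| by
    rw [regular_star, regular_add, regular_add, regular_star, regular_star]
    exact star_add (regular f) (regular g)

/-- The norm of the crossed product is the operator norm in the regular representation. -/
instance : NormedAddCommGroup (CrossedProduct γ) :=
  NormedAddCommGroup.induced _ _
    ({ toFun := regular, map_zero' := by
        refine regular_ext fun y u v => ?_
        exact zero_mul _
       map_add' := regular_add } : CrossedProduct γ →+ MatrixFunctions W Y)
    regular_injective

theorem norm_eq (f : CrossedProduct γ) : ‖f‖ = ‖regular f‖ := rfl

theorem isometry_regular : Isometry (regular : CrossedProduct γ → MatrixFunctions W Y) :=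
  Isometry.of_dist_eq fun _ _ => rfl

instance : NonUnitalNormedRing (CrossedProduct γ) where
  __ : NonUnitalRing (CrossedProduct γ) := inferInstance
  __ : NormedAddCommGroup (CrossedProduct γ) := inferInstance
  norm_mul_le f g := by
    rw [norm_eq, norm_eq, norm_eq, regular_mul]
    exact norm_mul_le (regular f) (regular g)

instance : NormedSpace ℂ (CrossedProduct γ) where
  norm_smul_le z f := by
    rw [norm_eq, norm_eq, regular_smul]
    exact norm_smul_le z (regular f)

instance : CStarRing (CrossedProduct γ) where
  norm_mul_self_le f := by
    rw [norm_eq, norm_eq, regular_mul, regular_star]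
    exact CStarRing.norm_mul_self_le (regular f)

theorem continuous_entry (y : Y) (u v : W) :
    Continuous fun F : MatrixFunctions W Y => F.entry y u v := by
  have h : LipschitzWith 1 fun F : MatrixFunctions W Y => F.entry y u v := by
    refine LipschitzWith.of_dist_le_mul fun F G => ?_
    rw [NNReal.coe_one, one_mul, dist_eq_norm, dist_eq_norm]
    calc ‖F.entry y u v - G.entry y u v‖ ≤ ‖(F - G).toFun y‖ :=
          CStarMatrix.norm_entry_le_norm (M := (F - G).toFun y)
      _ ≤ ‖F - G‖ := (ZeroAtInftyContinuousMap.toBCF (F - G)).norm_coe_le_norm y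
  exact h.continuous

theorem isClosed_range_regular :
    IsClosed (Set.range (regular : CrossedProduct γ → MatrixFunctions W Y)) := by
  have h : Set.range (regular : CrossedProduct γ → MatrixFunctions W Y) =
      {F | ∀ (y : Y) (u v : W), F.entry y u v =
        F.entry (v • y) (u * v⁻¹) 1 * (γ.val (u • y) (u * v⁻¹) v : ℂ)} := by
    ext F
    constructor
    · rintro ⟨f, rfl⟩ y u v
      have h1 : (u * v⁻¹) • v • y = u • y := by rw [smul_smul, inv_mul_cancel_right]
      simp [regular_apply, h1, TwoCocycle.val, γ.one_right]
    · intro hF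
      refine ⟨ofCoeff γ fun w =>
        { toFun := fun y => F.entry (w⁻¹ • y) w 1
          continuous_toFun := ?_
          zero_at_infty' := ?_ }, ?_⟩
      · have h1 : Continuous fun y => F.toFun y w 1 :=
          (continuous_apply_apply w (1 : W)).comp F.continuous_toFun
        exact h1.comp (continuous_const_smul w⁻¹)
      · have h1 : Tendsto (fun y => F.toFun y w 1) (cocompact Y) (𝓝 0) :=
          ((continuous_apply_apply w (1 : W)).tendsto (0 : W → W → ℂ)).comp F.zero_at_infty'
        exact h1.comp (Homeomorph.smul w⁻¹).isClosedEmbedding.tendsto_cocompact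
      · refine regular_ext fun y u v => ?_
        rw [regular_apply, hF y u v]
        have h1 : (u * v⁻¹)⁻¹ • u • y = v • y := by
          rw [smul_smul, mul_inv_rev, inv_inv, inv_mul_cancel_right]
        change F.entry ((u * v⁻¹)⁻¹ • u • y) (u * v⁻¹) 1 * _ = _
        rw [h1]
  rw [h]
  simp only [Set.ofPred_forall]
  refine isClosed_iInter fun y => isClosed_iInter fun u => isClosed_iInter fun v => ?_
  exact isClosed_eq (continuous_entry y u v) ((continuous_entry _ _ _).mul continuous_const)

instance : CompleteSpace (CrossedProduct γ) :=
  isometry_regular.isUniformInducing.completeSpace isClosed_range_regular.isComplete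

instance : IsScalarTower ℂ (CrossedProduct γ) (CrossedProduct γ) where
  smul_assoc z f g := regular_injective <| by
    rw [smul_eq_mul, smul_eq_mul, regular_mul, regular_smul, regular_smul, regular_mul]
    exact smul_mul_assoc z (regular f) (regular g)

instance : SMulCommClass ℂ (CrossedProduct γ) (CrossedProduct γ) where
  smul_comm z f g := regular_injective <| by
    rw [smul_eq_mul, smul_eq_mul, regular_mul, regular_smul, regular_smul, regular_mul]
    exact (mul_smul_comm z (regular f) (regular g)).symm

instance : StarModule ℂ (CrossedProduct γ) where
  star_smul z f := regular_injective <| by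
    rw [regular_star, regular_smul, regular_smul, regular_star]
    exact star_smul z (regular f)

instance : NonUnitalCStarAlgebra (CrossedProduct γ) where

end CrossedProduct

end CrossedProducts

/-! ### Orbit spaces -/

section OrbitSpaces

/-- The orbit space `X/N` with the quotient topology. -/
def OrbitSpace {W : Type*} [Group W] (N : Subgroup W) (X : Type*) [MulAction W X] : Type _ :=
  MulAction.orbitRel.Quotient N X

namespace OrbitSpace

variable {W X : Type*} [Group W] (N : Subgroup W) [MulAction W X]

/-- The quotient map `X → X/N`. -/
def mk (x : X) : OrbitSpace N X := Quotient.mk (MulAction.orbitRel N X) x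

instance [TopologicalSpace X] : TopologicalSpace (OrbitSpace N X) :=
  inferInstanceAs (TopologicalSpace (Quotient (MulAction.orbitRel N X)))

theorem rel_smul [hN : N.Normal] (w : W) (x y : X) (h : MulAction.orbitRel N X x y) :
    MulAction.orbitRel N X (w • x) (w • y) := by
  obtain ⟨n, rfl⟩ := h
  exact ⟨⟨w * n * w⁻¹, hN.conj_mem n n.2 w⟩, by
    change (w * n * w⁻¹) • w • y = w • (n : W) • y
    simp only [smul_smul, inv_mul_cancel_right]⟩

/-- If `N` is normal then `W`, hence also each of its subgroups, acts on `X/N` by `w[x] = [wx]`. -/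
instance [N.Normal] : MulAction W (OrbitSpace N X) where
  smul w := Quotient.map (sa := MulAction.orbitRel N X) (sb := MulAction.orbitRel N X) (w • ·)
    (rel_smul N w)
  one_smul := by
    rintro ⟨x⟩
    exact congrArg (mk N) (one_smul W x)
  mul_smul v w := by
    rintro ⟨x⟩
    exact congrArg (mk N) (mul_smul v w x)

theorem smul_mk [N.Normal] (w : W) (x : X) : w • mk N x = mk N (w • x) := rfl

instance [TopologicalSpace X] [ContinuousConstSMul W X] [N.Normal] :
    ContinuousConstSMul W (OrbitSpace N X) where
  continuous_const_smul w :=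
    Continuous.quotient_map' (s := MulAction.orbitRel N X) (t := MulAction.orbitRel N X)
      (continuous_const_smul w) (rel_smul N w)

instance (R : Subgroup W) [TopologicalSpace X] [ContinuousConstSMul W X] [N.Normal] :
    ContinuousConstSMul R (OrbitSpace N X) where
  continuous_const_smul r := continuous_const_smul (r : W)

end OrbitSpace

end OrbitSpaces

/-! ### Twisted actions on Hilbert modules -/

section TwistedActions

open HilbertModule

variable {W X E : Type*} [Group W] [TopologicalSpace X] [MulAction W X] [ContinuousConstSMul W X]
  [NormedAddCommGroup E] [NormedSpace ℂ E] [HilbertModule C₀(X, ℂ) E]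

/-- An `(α, γ)`-twisted action `U` of `W` on the Hilbert `C₀(X)`-module `E`. In the last law the
multiplier `γ(v, w)⋆` acts on `E`; the vector `η m`, for `m` a multiplier, is determined by
`⟨ζ | η m⟩ = ⟨ζ | η⟩ m` for all `ζ`. -/
structure TwistedAction (γ : TwoCocycle W X) (E : Type*) [NormedAddCommGroup E] [NormedSpace ℂ E]
    [HilbertModule C₀(X, ℂ) E] where
  U : W → E ≃ₗ[ℂ] E
  map_act : ∀ (w : W) (ξ : E) (b : C₀(X, ℂ)), U w (act ξ b) = act (U w ξ) (alphaC0 w b)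
  ip_map : ∀ (w : W) (ξ η : E), (ip (U w ξ) (U w η) : C₀(X, ℂ)) = alphaC0 w (ip ξ η)
  map_map : ∀ (v w : W) (ζ ξ : E) (x : X),
    (ip ζ (U v (U w ξ)) : C₀(X, ℂ)) x =
      (ip ζ (U (v * w) ξ) : C₀(X, ℂ)) x * star (γ.val x v w : ℂ)

/-- `E` with the degenerate inner product `⟨ξ | η⟩(x)`. -/
@[nolint unusedArguments]
def PreFiber (E : Type*) {X : Type*} [TopologicalSpace X] (_x : X) : Type _ := E

namespace PreFiber

variable (x : X)

instance : AddCommGroup (PreFiber E x) := inferInstanceAs (AddCommGroup E)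

instance : Module ℂ (PreFiber E x) := inferInstanceAs (Module ℂ E)

/-- The identity map `E → PreFiber E x`. -/
def of : E ≃ₗ[ℂ] PreFiber E x := LinearEquiv.refl ℂ E

/-- The degenerate inner product `⟨ξ | η⟩(x)`. -/
abbrev core : PreInnerProductSpace.Core ℂ (PreFiber E x) where
  inner ξ η := (ip ((of x).symm ξ) ((of x).symm η) : C₀(X, ℂ)) x
  conj_inner_symm ξ η := by
    change star ((ip ((of x).symm η) ((of x).symm ξ) : C₀(X, ℂ)) x) = _
    rw [← star_ip]
    exact star_star _
  re_inner_nonneg ξ := by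
    obtain ⟨b, hb⟩ := ip_self_nonneg (B := C₀(X, ℂ)) ((of x).symm ξ)
    rw [hb]
    change 0 ≤ (starRingEnd ℂ (b x) * b x).re
    rw [← Complex.normSq_eq_conj_mul_self]
    exact Complex.normSq_nonneg _
  add_left ξ η ζ := by
    rw [map_add, ip_add_left]
    rfl
  smul_left ξ η z := by
    rw [map_smul, ip_smul_left]
    rfl

instance : SeminormedAddCommGroup (PreFiber E x) :=
  InnerProductSpace.Core.toSeminormedAddCommGroup (c := core x)

instance : InnerProductSpace ℂ (PreFiber E x) := InnerProductSpace.ofCore (core x)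

theorem inner_of (ξ η : E) : inner ℂ (of x ξ) (of x η) = (ip ξ η : C₀(X, ℂ)) x := rfl

end PreFiber

/-- The fibre `E_x = E ⊗_{C₀(X)} ℂ_x`. Since `ξ ⊗ z = z ξ ⊗ 1` and
`⟨ξ ⊗ 1 | η ⊗ 1⟩ = ⟨ξ | η⟩(x)`, it is the Hilbert space completion of `E` with respect to the
degenerate inner product `⟨ξ | η⟩(x)`. -/
abbrev Fiber (E : Type*) {X : Type*} [TopologicalSpace X] [NormedAddCommGroup E] [NormedSpace ℂ E]
    [HilbertModule C₀(X, ℂ) E] (x : X) : Type _ :=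
  UniformSpace.Completion (PreFiber E x)

/-- The vector `ξ(x) = ξ ⊗ 1 ∈ E_x`. -/
def evalFiber (x : X) (ξ : E) : Fiber E x := (PreFiber.of x ξ : PreFiber E x)

namespace TwistedAction

variable {γ : TwoCocycle W X} (T : TwistedAction γ E)

/-- The isometry of pre-Hilbert spaces that induces `I_{w,x}`. -/
def preFiberMap (w : W) (x y : X) (h : w • x = y) : PreFiber E x →ₗᵢ[ℂ] PreFiber E y :=
  LinearMap.isometryOfInner
    ((PreFiber.of y).toLinearMap ∘ₗ (T.U w).toLinearMap ∘ₗ (PreFiber.of x).symm.toLinearMap)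
    fun ξ η => by
      change (ip (T.U w ((PreFiber.of x).symm ξ)) (T.U w ((PreFiber.of x).symm η)) : C₀(X, ℂ)) y
        = (ip ((PreFiber.of x).symm ξ) ((PreFiber.of x).symm η) : C₀(X, ℂ)) x
      rw [T.ip_map, alphaC0_apply, ← h, inv_smul_smul]

/-- The operator `I_{w,x} : E_x → E_y`, where `y = w x`. -/
def I (w : W) (x y : X) (h : w • x = y) : Fiber E x →L[ℂ] Fiber E y :=
  (T.preFiberMap w x y h).toContinuousLinearMap.completion

/-- The defining property `I_{w,x}(ξ(x)) = (U_w ξ)(w x)`. -/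
theorem I_evalFiber (w : W) (x y : X) (h : w • x = y) (ξ : E) :
    T.I w x y h (evalFiber x ξ) = evalFiber y (T.U w ξ) :=
  ContinuousLinearMap.completion_apply_coe _ _

/-- For `w ∈ W_x` and `c ∈ ℂ`: the operator `I_{w,x}` on `E_x` is the scalar `c`. If `E_x ≠ 0`
there is at most one such `c`, and this `c` is `ι_{w,x}`. -/
def ActsByScalar (x : X) (w : MulAction.stabilizer W x) (c : ℂ) : Prop :=
  T.I (w : W) x x w.2 = c • ContinuousLinearMap.id ℂ (Fiber E x)

/-- The set `W'_x` of those `w ∈ W_x` for which `I_{w,x}` is a scalar operator. -/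
def scalarStabilizer (x : X) : Set W :=
  {w | ∃ h : w ∈ MulAction.stabilizer W x, ∃ c : ℂ, T.ActsByScalar x ⟨w, h⟩ c}

end TwistedAction

/-- A unitary projective representation of `G` on `H` with multiplier `η`:
`π(g₁) π(g₂) = η(g₁, g₂) π(g₁ g₂)`. -/
structure ProjRep (G : Type*) [Group G] (η : G → G → Circle) (H : Type*) [NormedAddCommGroup H]
    [InnerProductSpace ℂ H] where
  toFun : G → H ≃ₗᵢ[ℂ] H
  map_mul : ∀ (g₁ g₂ : G) (v : H), toFun g₁ (toFun g₂ v) = (η g₁ g₂ : ℂ) • toFun (g₁ * g₂) v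

/-- `H` is nonzero and has no proper nonzero invariant subspace. -/
def ProjRep.IsIrreducible {G : Type*} [Group G] {η : G → G → Circle} {H : Type*}
    [NormedAddCommGroup H] [InnerProductSpace ℂ H] (π : ProjRep G η H) : Prop :=
  Nontrivial H ∧ ∀ S : Submodule ℂ H, (∀ g, ∀ v ∈ S, π.toFun g v ∈ S) → S = ⊥ ∨ S = ⊤

namespace TwoCocycle

/-- The restriction of `γ_x` to the isotropy group `W_x`. -/
def atStabilizer (γ : TwoCocycle W X) (x : X) (v w : MulAction.stabilizer W x) : Circle :=
  γ.val x v w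

end TwoCocycle

namespace TwistedAction

variable {γ : TwoCocycle W X} (T : TwistedAction γ E)

/-- The `γ_x`-representation `π` of `W_x` lies over the complex conjugate of `ι_x`: each
`w' ∈ W'_x` acts in `π` by the complex conjugate of `ι_{w',x}`. -/
def LiesOver (x : X) {H : Type*} [NormedAddCommGroup H] [InnerProductSpace ℂ H]
    (π : ProjRep (MulAction.stabilizer W x) (γ.atStabilizer x) H) : Prop :=
  ∀ (w : MulAction.stabilizer W x) (c : ℂ), T.ActsByScalar x w c →
    ∀ h : H, π.toFun w h = star c • h

/-- The `γ_x`-representation `π` of `W_x` appears in the contragredient of `I_x`: there is a linear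
isometric intertwiner from `H` to the complex conjugate of the Hilbert space `E_x`, which is the
same as a conjugate-linear isometric intertwiner from `H` to `E_x`. -/
def AppearsInContragredient (x : X) {H : Type*} [NormedAddCommGroup H] [InnerProductSpace ℂ H]
    (π : ProjRep (MulAction.stabilizer W x) (γ.atStabilizer x) H) : Prop :=
  ∃ J : H →ₛₗᵢ[starRingEnd ℂ] Fiber E x,
    ∀ (w : MulAction.stabilizer W x) (h : H), J (π.toFun w h) = T.I (w : W) x x w.2 (J h)

/-- The completeness condition: for every `x`, each irreducible unitary `γ_x`-representation of
`W_x` lying over the complex conjugate of `ι_x` appears in the contragredient of `I_x`. (Irreducible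
projective representations of finite groups are finite-dimensional, so it is no restriction to take
Hilbert spaces in the lowest universe.) -/
def CompletenessCondition : Prop :=
  ∀ (x : X) (H : Type) [NormedAddCommGroup H] [InnerProductSpace ℂ H] [CompleteSpace H]
    (π : ProjRep (MulAction.stabilizer W x) (γ.atStabilizer x) H),
    π.IsIrreducible → T.LiesOver x π → T.AppearsInContragredient x π

/-- The C⋆-algebra `K_{C₀(X)}(E)^W` of those compact operators on `E` that commute with all
`U_w`. -/
def fixedCompacts : NonUnitalStarSubalgebra ℂ (Adjointable C₀(X, ℂ) E) where
  carrier := {k | k ∈ compacts C₀(X, ℂ) E ∧ ∀ (w : W) (ξ : E), T.U w (k ξ) = k (T.U w ξ)}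
  add_mem' {k l} hk hl := ⟨add_mem hk.1 hl.1, fun w ξ => by
    simp only [Adjointable.add_apply, map_add, hk.2, hl.2]⟩
  zero_mem' := ⟨zero_mem _, fun w ξ => by simp only [Adjointable.zero_apply, map_zero]⟩
  mul_mem' {k l} hk hl := ⟨mul_mem hk.1 hl.1, fun w ξ => by
    simp only [Adjointable.mul_apply, hk.2, hl.2]⟩
  smul_mem' z k hk := ⟨SMulMemClass.smul_mem z hk.1, fun w ξ => by
    simp only [Adjointable.smul_apply, map_smul, hk.2]⟩
  star_mem' {k} hk := ⟨star_mem hk.1, fun w ξ => ext_ip C₀(X, ℂ) fun ζ => by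
    obtain ⟨ζ, rfl⟩ := (T.U w).surjective ζ
    rw [T.ip_map, ← Adjointable.ip_apply_left, ← Adjointable.ip_apply_left, ← hk.2, T.ip_map]⟩

theorem continuous_U (w : W) : Continuous (T.U w) := by
  have h : Isometry (T.U w) := AddMonoidHomClass.isometry_of_norm _ fun ξ => by
    refine (sq_eq_sq₀ (norm_nonneg _) (norm_nonneg _)).mp ?_
    rw [norm_sq (B := C₀(X, ℂ)), norm_sq (B := C₀(X, ℂ)), T.ip_map,
      norm_alphaC0]
  exact h.continuous

instance : IsClosed (T.fixedCompacts : Set (Adjointable C₀(X, ℂ) E)) := by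
  have h : (T.fixedCompacts : Set (Adjointable C₀(X, ℂ) E)) =
      (compacts C₀(X, ℂ) E : Set (Adjointable C₀(X, ℂ) E)) ∩
        ⋂ (w : W) (ξ : E), {k | T.U w (k ξ) = k (T.U w ξ)} := by
    ext k
    simp only [Set.mem_inter_iff, Set.mem_iInter]
    rfl
  have hc : ∀ ξ : E, Continuous fun k : Adjointable C₀(X, ℂ) E => k ξ := fun ξ =>
    (ContinuousLinearMap.apply ℂ E ξ).continuous.comp Adjointable.isometry_toCLM.continuous
  rw [h]
  refine IsClosed.inter inferInstance (isClosed_iInter fun w => isClosed_iInter fun ξ => ?_)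
  exact isClosed_eq ((T.continuous_U w).comp (hc ξ)) (hc _)

end TwistedAction

end TwistedActions

end

/-! Write `N` for `W'`, `g` for the constant cocycle, and `F` for the `N`-invariant vectors of `E`.
The equivalence is implemented by `F`: the operators `U_r`, `r ∈ R`, act on it, `⟨ξ | η⟩ = ∑_r ⟨ξ |
U_r η⟩ r` is an inner product with values in the twisted crossed product, and restriction of
operators to `F` identifies `K(E)^W` with the compact operators of this module.

`F` is large enough. At `x₀` all of `N` acts trivially on the fibre, so comparing phases there shows
that `g` is trivial on `N × N` and that `g(n, w) = g(w, w⁻¹ n w)` (`isInflated`). Hence averaging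
over `N` produces invariant vectors and every `U_w` preserves `F`. The elements of `N` that fix a
point `x` act trivially on `E_x`, so averaging a section localised at `x` does not change its value
there: `F` has the same values as `E` at every point (`exists_mem_invariants_eval_eq`).

`F` is a Hilbert module. The coefficient at `1` of `⟨ξ | ξ⟩` is the old inner product. Applied to
all `ξ q` this gives positivity, because a negative part would be detected by the coefficient at `1`
(`exists_eq_star_mul_self`). The old and new norms are equivalent since `R` is finite, so `F` is
complete.

`F` is full, and this is where completeness enters. By a partition of unity, density of the inner
products can be checked at one point of `X/N` at a time, where it says that the numbers `⟨ξ | U_r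
η⟩(x)` satisfy no linear relation in `r`. Localising reduces this to relations `∑ conj(a(r)) U_r =
0` at `x` with `a` supported in the isotropy group of the orbit of `x`. Such `a` form a subspace of
`ℓ²(R)` stable under a twisted regular representation of `W_x`. If it is nonzero, a minimal
invariant subspace is an irreducible representation on which `W'_x` acts trivially. It therefore
occurs in the contragredient of `E_x`, where all relations act as zero. But the relation adjoint to
a nonzero element of that subspace does not act as zero on that element (`relations_eq_bot`).

The compact operators match. For `ξ, η ∈ F` the invariant operator `∑_r |U_r ξ⟩⟨U_r η|` restricts to
the rank-one operator `|ξ⟩⟨η|` over the crossed product (`restrictHom_sumKetbra`). Restriction is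
injective, hence isometric, and averaging over `N` and `R` shows that these operators span a dense
subspace of `K(E)^W` (`restrictHom_mem_compacts`). -/

noncomputable section

/-! ### Hilbert modules from an algebraic inner product -/

/-- A complex vector space with a nondegenerate positive `B`-valued inner product and a compatible
right action of `B`, before norming and completing. -/
structure PreHilbertModule (B F : Type*) [NonUnitalCStarAlgebra B] [AddCommGroup F]
    [Module ℂ F] where
  ip : F → F → B
  act : F → B → F
  ip_add_right : ∀ ξ η ζ : F, ip ξ (η + ζ) = ip ξ η + ip ξ ζ
  ip_smul_right : ∀ (z : ℂ) (ξ η : F), ip ξ (z • η) = z • ip ξ η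
  ip_act_right : ∀ (ξ η : F) (b : B), ip ξ (act η b) = ip ξ η * b
  star_ip : ∀ ξ η : F, star (ip ξ η) = ip η ξ
  ip_self_nonneg : ∀ ξ : F, ∃ b : B, ip ξ ξ = star b * b
  definite : ∀ ξ : F, ip ξ ξ = 0 → ξ = 0

namespace PreHilbertModule

variable {B F : Type*} [NonUnitalCStarAlgebra B] [AddCommGroup F] [Module ℂ F]

section Inner

variable (D : PreHilbertModule B F)

theorem ip_zero_right (ξ : F) : D.ip ξ 0 = 0 := by
  simpa using D.ip_smul_right 0 ξ 0

theorem ip_sub_right (ξ η ζ : F) : D.ip ξ (η - ζ) = D.ip ξ η - D.ip ξ ζ := by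
  have h := D.ip_smul_right (-1) ξ ζ
  rw [sub_eq_add_neg, D.ip_add_right, sub_eq_add_neg]
  simpa using h

theorem ip_sub_left (ξ η ζ : F) : D.ip (ξ - η) ζ = D.ip ξ ζ - D.ip η ζ := by
  rw [← D.star_ip, D.ip_sub_right, star_sub, D.star_ip, D.star_ip]

theorem ip_add_left (ξ η ζ : F) : D.ip (ξ + η) ζ = D.ip ξ ζ + D.ip η ζ := by
  rw [← D.star_ip, D.ip_add_right, star_add, D.star_ip, D.star_ip]

theorem ip_smul_left (z : ℂ) (ξ η : F) : D.ip (z • ξ) η = star z • D.ip ξ η := by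
  rw [← D.star_ip, D.ip_smul_right, star_smul, D.star_ip]

theorem ip_act_left (ξ η : F) (b : B) : D.ip (D.act ξ b) η = star b * D.ip ξ η := by
  rw [← D.star_ip, D.ip_act_right, star_mul, D.star_ip]

/-- The Cauchy–Schwarz inequality. -/
theorem norm_ip_sq_le (ξ η : F) : ‖D.ip ξ η‖ ^ 2 ≤ ‖D.ip ξ ξ‖ * ‖D.ip η η‖ := by
  let _ : PartialOrder B := CStarAlgebra.spectralOrder B
  have _ : StarOrderedRing B := CStarAlgebra.spectralOrderedRing B
  rcases eq_or_ne ξ 0 with h | h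
  · have h0 : D.ip ξ η = 0 := by rw [h, ← D.star_ip, D.ip_zero_right, star_zero]
    rw [h0, norm_zero, zero_pow two_ne_zero]
    exact mul_nonneg (norm_nonneg _) (norm_nonneg _)
  set c : ℝ := ‖D.ip ξ ξ‖ with hc
  have hcpos : 0 < c := norm_pos_iff.mpr fun h0 => h (D.definite ξ h0)
  set a : B := D.ip ξ η with ha
  have hsa : star a = D.ip η ξ := D.star_ip ξ η
  have hpos : (0 : B) ≤ star a * D.ip ξ ξ * a - c • (star a * a)
      - c • (star a * a) + c • (c • D.ip η η) := by
    -- With `a = ⟨ξ | η⟩` and `c = ‖⟨ξ | ξ⟩‖`, expanding the square and using `a⋆ ⟨ξ | ξ⟩ a ≤ c a⋆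
    -- a` leaves `a⋆ a ≤ c ⟨η | η⟩`.
    obtain ⟨b, hb⟩ := D.ip_self_nonneg (D.act ξ a - (c : ℂ) • η)
    have h2 : star b * b = star a * D.ip ξ ξ * a - (c : ℂ) • (star a * a)
        - (c : ℂ) • (star a * a) + (c : ℂ) • ((c : ℂ) • D.ip η η) := by
      rw [← hb]
      have hs : star (c : ℂ) = c := Complex.conj_ofReal _
      simp only [ip_sub_left, ip_sub_right, ip_act_left, ip_act_right, ip_smul_left,
        ip_smul_right, ← hsa, ← ha, hs, sub_mul, smul_mul_assoc, mul_assoc, smul_sub]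
      abel
    simp only [Complex.coe_smul] at h2
    rw [← h2]
    exact star_mul_self_nonneg b
  have hconj : star a * D.ip ξ ξ * a ≤ c • (star a * a) :=
    CStarAlgebra.star_left_conjugate_le_norm_smul (D.star_ip ξ ξ)
  have h1 : c • (star a * a) ≤ c • (c • D.ip η η) := by
    rw [← sub_nonneg] at hconj ⊢
    refine (add_nonneg hpos hconj).trans (le_of_eq ?_)
    abel
  rw [smul_le_smul_iff_of_pos_left hcpos] at h1
  have h5 := CStarAlgebra.norm_le_norm_of_nonneg_of_le (star_mul_self_nonneg a) h1
  rwa [CStarRing.norm_star_mul_self, norm_smul, Real.norm_of_nonneg hcpos.le, ← sq] at h5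

/-- The transport of a pre-Hilbert module along a linear isomorphism. -/
def comap {F' : Type*} [AddCommGroup F'] [Module ℂ F'] (e : F' ≃ₗ[ℂ] F) :
    PreHilbertModule B F' where
  ip ξ η := D.ip (e ξ) (e η)
  act ξ b := e.symm (D.act (e ξ) b)
  ip_add_right ξ η ζ := by rw [map_add, D.ip_add_right]
  ip_smul_right z ξ η := by rw [map_smul, D.ip_smul_right]
  ip_act_right ξ η b := by rw [e.apply_symm_apply, D.ip_act_right]
  star_ip ξ η := D.star_ip _ _
  ip_self_nonneg ξ := D.ip_self_nonneg _
  definite ξ h := (map_eq_zero_iff e e.injective).mp (D.definite _ h)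

end Inner

/-- The vector space `F`, to be normed by `‖ξ‖² = ‖⟨ξ | ξ⟩‖`. -/
@[nolint unusedArguments]
def Carrier (_D : PreHilbertModule B F) : Type _ := F

variable {D : PreHilbertModule B F}

instance : AddCommGroup D.Carrier := inferInstanceAs (AddCommGroup F)

instance : Module ℂ D.Carrier := inferInstanceAs (Module ℂ F)

variable (D) in
/-- The identity map. -/
def toCarrier : F ≃ₗ[ℂ] D.Carrier := LinearEquiv.refl ℂ F

instance : Norm D.Carrier := ⟨fun ξ => √‖D.ip (D.toCarrier.symm ξ) (D.toCarrier.symm ξ)‖⟩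

theorem norm_sq_toCarrier (ξ : F) : ‖D.toCarrier ξ‖ ^ 2 = ‖D.ip ξ ξ‖ :=
  Real.sq_sqrt (norm_nonneg _)

theorem normedSpaceCore : NormedSpace.Core ℂ D.Carrier where
  norm_nonneg _ := Real.sqrt_nonneg _
  norm_smul z ξ := by
    obtain ⟨ξ, rfl⟩ := D.toCarrier.surjective ξ
    change √‖D.ip (z • ξ) (z • ξ)‖ = ‖z‖ * √‖D.ip ξ ξ‖
    rw [D.ip_smul_left, D.ip_smul_right, norm_smul, norm_smul, norm_star, ← mul_assoc,
      Real.sqrt_mul (by positivity), Real.sqrt_mul_self (norm_nonneg z)]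
  norm_triangle ξ η := by
    obtain ⟨ξ, rfl⟩ := D.toCarrier.surjective ξ
    obtain ⟨η, rfl⟩ := D.toCarrier.surjective η
    change √‖D.ip (ξ + η) (ξ + η)‖ ≤ √‖D.ip ξ ξ‖ + √‖D.ip η η‖
    refine Real.sqrt_le_iff.mpr ⟨by positivity, ?_⟩
    have h (ξ η : F) : ‖D.ip ξ η‖ ≤ √‖D.ip ξ ξ‖ * √‖D.ip η η‖ := by
      rw [← Real.sqrt_mul (norm_nonneg _)]
      exact Real.le_sqrt_of_sq_le (D.norm_ip_sq_le ξ η)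
    have h1 := h ξ ξ
    have h2 := h ξ η
    have h3 := h η ξ
    have h4 := h η η
    have h5 : ‖D.ip (ξ + η) (ξ + η)‖ ≤
        (‖D.ip ξ ξ‖ + ‖D.ip η ξ‖) + (‖D.ip ξ η‖ + ‖D.ip η η‖) := by
      rw [D.ip_add_right, D.ip_add_left, D.ip_add_left]
      exact norm_add_le_of_le (norm_add_le _ _) (norm_add_le _ _)
    linarith
  norm_eq_zero_iff ξ := by
    change √‖D.ip ξ ξ‖ = 0 ↔ ξ = 0
    rw [Real.sqrt_eq_zero (norm_nonneg _), norm_eq_zero]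
    exact ⟨D.definite ξ, fun h => h ▸ D.ip_zero_right 0⟩

instance : NormedAddCommGroup D.Carrier := NormedAddCommGroup.ofCore normedSpaceCore

instance : NormedSpace ℂ D.Carrier := NormedSpace.ofCore normedSpaceCore

instance [h : CompleteSpace D.Carrier] : HilbertModule B D.Carrier where
  __ := h
  ip ξ η := D.ip (D.toCarrier.symm ξ) (D.toCarrier.symm η)
  act ξ b := D.toCarrier (D.act (D.toCarrier.symm ξ) b)
  ip_add_right _ _ _ := D.ip_add_right _ _ _
  ip_smul_right _ _ _ := D.ip_smul_right _ _ _
  ip_act_right _ _ _ := D.ip_act_right _ _ _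
  star_ip _ _ := D.star_ip _ _
  ip_self_nonneg _ := D.ip_self_nonneg _
  norm_sq ξ := norm_sq_toCarrier ξ

/-- If a norm on `F` is equivalent to that defined by the inner product, the identity map is an
isomorphism of normed spaces. -/
theorem exists_continuousLinearEquiv {E : Type*} [NormedAddCommGroup E] [NormedSpace ℂ E]
    (e : E ≃ₗ[ℂ] F) (C C' : ℝ) (h : ∀ ξ : E, ‖D.ip (e ξ) (e ξ)‖ ≤ C * ‖ξ‖ ^ 2)
    (h' : ∀ ξ : E, ‖ξ‖ ^ 2 ≤ C' * ‖D.ip (e ξ) (e ξ)‖) :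
    ∃ e' : E ≃L[ℂ] D.Carrier, ∀ ξ, e' ξ = D.toCarrier (e ξ) := by
  -- No sign is assumed for the constants, hence `max a 0`.
  have h1 (a b c : ℝ) (hb : 0 ≤ b) (hc : 0 ≤ c) (h : b ^ 2 ≤ a * c ^ 2) : b ≤ √(max a 0) * c := by
    refine abs_le_of_sq_le_sq' ?_ (by positivity) |>.2
    rw [mul_pow, Real.sq_sqrt (le_max_right _ _)]
    exact h.trans (by gcongr; exact le_max_left _ _)
  refine ⟨(e.trans D.toCarrier).toContinuousLinearEquivOfBounds
    (√(max C 0)) (√(max C' 0))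
    (fun ξ => h1 _ _ _ (norm_nonneg _) (norm_nonneg _) (by
      have := h ξ
      rwa [← norm_sq_toCarrier] at this))
    (fun ξ => h1 _ _ _ (norm_nonneg _) (norm_nonneg _) (by
      obtain ⟨ξ, rfl⟩ := (e.trans D.toCarrier).surjective ξ
      have := h' ξ
      rw [← norm_sq_toCarrier] at this
      rwa [LinearEquiv.symm_apply_apply])), fun ξ => rfl⟩

end PreHilbertModule

/-! ### Density of pointwise full submodules -/

/-- Let `V` be a space of sections, vanishing at infinity, of a family of seminormed spaces over a
locally compact Hausdorff space. A subspace that is closed under multiplication by `C₀(X)` and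
exhausts all fibres is dense. -/
theorem dense_of_forall_exists_eval_eq {X : Type*} [TopologicalSpace X] [LocallyCompactSpace X]
    [T2Space X] {V : Type*} [SeminormedAddCommGroup V] [Module ℂ V] {A : X → Type*}
    [∀ x, SeminormedAddCommGroup (A x)] [∀ x, NormedSpace ℂ (A x)] (ev : ∀ x, V →ₗ[ℂ] A x) (C : ℝ)
    (hnorm : ∀ (v : V) (ε : ℝ), 0 ≤ ε → (∀ x, ‖ev x v‖ ≤ ε) → ‖v‖ ≤ C * ε)
    (hcont : ∀ v, Continuous fun x => ‖ev x v‖)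
    (hzero : ∀ v, Tendsto (fun x => ‖ev x v‖) (cocompact X) (𝓝 0))
    (mul : C₀(X, ℂ) → V → V) (hmul : ∀ b v x, ev x (mul b v) = b x • ev x v)
    (M : Submodule ℂ V) (hM : ∀ b, ∀ m ∈ M, mul b m ∈ M)
    (hev : ∀ x v, ∃ m ∈ M, ev x m = ev x v) : Dense (M : Set V) := by
  intro v
  rw [Metric.mem_closure_iff]
  intro ε hε
  -- The `+ 1` and the absolute value allow `C` to be zero or negative and make the final estimate
  -- strict.
  set δ : ℝ := ε / (|C| + 1) with hδ
  have hδ0 : 0 < δ := by positivity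
  obtain ⟨K, hK, hKv⟩ : ∃ K, IsCompact K ∧ ∀ x ∉ K, ‖ev x v‖ < δ := by
    obtain ⟨K, hK, h⟩ := mem_cocompact.mp ((hzero v).eventually_lt_const hδ0)
    exact ⟨K, hK, fun x hx => h hx⟩
  choose m hmM hm using fun x => hev x v
  have hopen (x : X) : IsOpen {y | ‖ev y (v - m x)‖ < δ} :=
    isOpen_lt (hcont _) continuous_const
  obtain ⟨t, ht⟩ := hK.elim_finite_subcover (fun x => {y | ‖ev y (v - m x)‖ < δ}) hopen
    fun x _ => Set.mem_iUnion.mpr ⟨x, by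
      change ‖ev x (v - m x)‖ < δ
      rwa [map_sub, hm, sub_self, norm_zero]⟩
  obtain ⟨φ, hφ, hφc⟩ := PartitionOfUnity.exists_isSubordinate_of_locallyFinite_t2space hK
    (fun x : t => {y | ‖ev y (v - m x)‖ < δ}) (fun x => hopen x) (locallyFinite_of_finite _)
    (ht.trans fun y hy => by
      simp only [Set.mem_iUnion] at hy ⊢
      obtain ⟨i, hi, h⟩ := hy
      exact ⟨⟨i, hi⟩, h⟩)
  let b : t → C₀(X, ℂ) := fun i =>
    { toFun := fun x => (φ i x : ℂ)
      continuous_toFun := Complex.continuous_ofReal.comp (φ i).continuous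
      zero_at_infty' := by
        refine HasCompactSupport.is_zero_at_infty (f := fun x => (φ i x : ℂ)) ?_
        exact (hφc i).comp_left (g := ((↑) : ℝ → ℂ)) Complex.ofReal_zero }
  refine ⟨∑ i, mul (b i) (m i), M.sum_mem fun i _ => hM _ _ (hmM i), ?_⟩
  have hbound (x : X) : ‖ev x (v - ∑ i, mul (b i) (m i))‖ ≤ δ := by
    have hle : ∑ i, φ i x ≤ 1 := by
      rw [← finsum_eq_sum_of_fintype]
      exact φ.sum_le_one x
    have h0 (i : t) : 0 ≤ φ i x := φ.nonneg i x
    -- Both summands are small for different reasons: `1 - ∑ φ_i` vanishes on `K` while `v` is small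
    -- off `K`, and each `v - m_i` is small on the support of `φ_i`.
    have hdec : ev x (v - ∑ i, mul (b i) (m i)) =
        ((1 - ∑ i, φ i x : ℝ) : ℂ) • ev x v + ∑ i, (φ i x : ℂ) • ev x (v - m i) := by
      have hb (i : t) : b i x = (φ i x : ℂ) := rfl
      simp only [map_sub, map_sum, hmul, smul_sub, Finset.sum_sub_distrib, hb, ← Finset.sum_smul,
        Complex.ofReal_sub, Complex.ofReal_one, Complex.ofReal_sum, sub_smul, one_smul]
      abel
    have h1 : ‖((1 - ∑ i, φ i x : ℝ) : ℂ) • ev x v‖ ≤ (1 - ∑ i, φ i x) * δ := by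
      rw [norm_smul, Complex.norm_real, Real.norm_of_nonneg (by linarith)]
      by_cases hx : x ∈ K
      · have h2 : ∑ i, φ i x = 1 := by
          rw [← finsum_eq_sum_of_fintype]
          exact φ.sum_eq_one hx
        rw [h2, sub_self, zero_mul, zero_mul]
      · exact mul_le_mul_of_nonneg_left (hKv x hx).le (by linarith)
    have h2 : ‖∑ i, (φ i x : ℂ) • ev x (v - m i)‖ ≤ (∑ i, φ i x) * δ := by
      rw [Finset.sum_mul]
      refine norm_sum_le_of_le _ fun i _ => ?_
      rw [norm_smul, Complex.norm_real, Real.norm_of_nonneg (h0 i)]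
      by_cases hx : x ∈ tsupport (φ i)
      · exact mul_le_mul_of_nonneg_left (le_of_lt (hφ i hx)) (h0 i)
      · rw [image_eq_zero_of_notMem_tsupport hx, zero_mul, zero_mul]
    rw [hdec]
    refine (norm_add_le_of_le h1 h2).trans (le_of_eq ?_)
    ring
  rw [dist_eq_norm]
  calc ‖v - ∑ i, mul (b i) (m i)‖ ≤ C * δ := hnorm _ _ hδ0.le hbound
    _ ≤ |C| * δ := by gcongr; exact le_abs_self C
    _ < (|C| + 1) * δ := by gcongr; exact lt_add_one _
    _ = ε := by rw [hδ]; field_simp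

/-! ### Functions on orbit spaces -/

section Separation

variable {X : Type*} [TopologicalSpace X] [LocallyCompactSpace X] [T2Space X]

/-- Urysohn's lemma for a compact and a closed set, with a function in `C₀(X)`. -/
theorem exists_zeroAtInfty_one_zero {K t : Set X} (hK : IsCompact K) (ht : IsClosed t)
    (h : Disjoint K t) : ∃ b : C₀(X, ℂ), (∀ x ∈ K, b x = 1) ∧ ∀ x ∈ t, b x = 0 := by
  obtain ⟨f, h1, h0, hc, -⟩ := exists_continuous_one_zero_of_isCompact hK ht h
  refine ⟨{ toFun := fun x => (f x : ℂ)
            continuous_toFun := Complex.continuous_ofReal.comp f.continuous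
            zero_at_infty' := ?_ }, fun x hx => ?_, fun x hx => ?_⟩
  · refine HasCompactSupport.is_zero_at_infty (f := fun x => (f x : ℂ)) ?_
    exact hc.comp_left (g := ((↑) : ℝ → ℂ)) Complex.ofReal_zero
  · change (f x : ℂ) = 1
    simp [h1 hx]
  · change (f x : ℂ) = 0
    simp [h0 hx]

/-- Points of a finite set are separated by `C₀(X)`. -/
theorem exists_zeroAtInfty_apply_eq_ite {s : Set X} (hs : s.Finite) (x : X) :
    ∃ b : C₀(X, ℂ), b x = 1 ∧ ∀ y ∈ s, y ≠ x → b y = 0 := by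
  obtain ⟨b, h1, h0⟩ := exists_zeroAtInfty_one_zero (K := {x}) (t := s \ {x}) isCompact_singleton
    (hs.subset Set.sdiff_subset).isClosed Set.disjoint_sdiff_right
  exact ⟨b, h1 x rfl, fun y hy hne => h0 y ⟨hy, hne⟩⟩

end Separation

namespace OrbitSpace

variable {W X : Type*} [Group W] [Finite W] (N : Subgroup W) [MulAction W X] [TopologicalSpace X]
  [ContinuousConstSMul W X]

instance continuousConstSMul_subgroup : ContinuousConstSMul N X :=
  ⟨fun n => continuous_const_smul (n : W)⟩

theorem mk_surjective : Function.Surjective (mk N : X → OrbitSpace N X) := Quotient.mk_surjective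

theorem mk_eq_mk_iff (x y : X) : mk N x = mk N y ↔ ∃ n ∈ N, n • x = y := by
  constructor
  · intro h
    obtain ⟨n, hn⟩ := (Quotient.exact (s := MulAction.orbitRel N X) h.symm)
    exact ⟨n, n.2, hn⟩
  · rintro ⟨n, hn, rfl⟩
    exact (Quotient.sound (s := MulAction.orbitRel N X) ⟨⟨n, hn⟩, rfl⟩ : mk N (n • x) = mk N x).symm

theorem mk_smul {n : W} (hn : n ∈ N) (x : X) : mk N (n • x) = mk N x :=
  ((mk_eq_mk_iff N _ _).mpr ⟨n, hn, rfl⟩).symm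

theorem isOpenQuotientMap_mk : IsOpenQuotientMap (mk N : X → OrbitSpace N X) :=
  MulAction.isOpenQuotientMap_quotientMk (Γ := N) (T := X)

theorem continuous_mk : Continuous (mk N : X → OrbitSpace N X) :=
  (isOpenQuotientMap_mk N).continuous

instance [LocallyCompactSpace X] [T2Space X] : T2Space (OrbitSpace N X) :=
  t2Space_of_properlyDiscontinuousSMul_of_t2Space (Γ := N) (T := X)

instance [LocallyCompactSpace X] [T2Space X] : LocallyCompactSpace (OrbitSpace N X) :=
  have := (isOpenQuotientMap_mk (X := X) N).weaklyLocallyCompactSpace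
  inferInstance

/-- The quotient map is proper: the saturation of a closed set is a finite union of closed
translates, and the fibres are finite orbits. This makes pull-backs of functions vanish at infinity.
-/
theorem tendsto_mk_cocompact :
    Tendsto (mk N : X → OrbitSpace N X) (cocompact X) (cocompact (OrbitSpace N X)) := by
  have hq := isOpenQuotientMap_mk (X := X) N
  have h : IsProperMap (mk N : X → OrbitSpace N X) := by
    refine isProperMap_iff_isClosedMap_and_compact_fibers.mpr ⟨hq.continuous, fun s hs => ?_,
      fun y => ?_⟩
    · rw [← hq.isQuotientMap.isClosed_preimage]
      have : mk N ⁻¹' (mk N '' s) = ⋃ n : N, (fun x => (n : W) • x) ⁻¹' s := by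
        ext x
        simp only [Set.mem_preimage, Set.mem_image, Set.mem_iUnion]
        constructor
        · rintro ⟨y, hy, h⟩
          obtain ⟨n, hn, rfl⟩ := (mk_eq_mk_iff N _ _).mp h.symm
          exact ⟨⟨n, hn⟩, hy⟩
        · rintro ⟨n, h⟩
          exact ⟨_, h, mk_smul N n.2 x⟩
      rw [this]
      exact isClosed_iUnion_of_finite fun n => hs.preimage (continuous_const_smul (n : W))
    · obtain ⟨x, rfl⟩ := mk_surjective N y
      refine Set.Finite.isCompact ((Set.finite_range fun n : N => (n : W) • x).subset ?_)
      intro y hy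
      obtain ⟨n, hn, rfl⟩ := (mk_eq_mk_iff N _ _).mp (Set.mem_singleton_iff.mp hy).symm
      exact ⟨⟨n, hn⟩, rfl⟩
  intro s hs
  obtain ⟨K, hK, hKs⟩ := mem_cocompact.mp hs
  exact mem_map.mpr (mem_cocompact.mpr ⟨mk N ⁻¹' K, h.isCompact_preimage hK, fun x hx => hKs hx⟩)

/-- The pull-back of a function along `X → X/N`. -/
def pullback (b : C₀(OrbitSpace N X, ℂ)) : C₀(X, ℂ) where
  toFun x := b (mk N x)
  continuous_toFun := (map_continuous b).comp (continuous_mk N)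
  zero_at_infty' := (zero_at_infty b).comp (tendsto_mk_cocompact N)

theorem pullback_apply (b : C₀(OrbitSpace N X, ℂ)) (x : X) : pullback N b x = b (mk N x) := rfl

/-- The function on `X/N` induced by an `N`-invariant function on `X`. -/
def descend (b : C₀(X, ℂ)) (hb : ∀ n ∈ N, ∀ x, b (n • x) = b x) : C₀(OrbitSpace N X, ℂ) where
  toFun := Quotient.lift (s := MulAction.orbitRel N X) b (by
    rintro _ y ⟨n, rfl⟩
    exact hb n n.2 y)
  continuous_toFun := Continuous.quotient_lift (s := MulAction.orbitRel N X) (map_continuous b) _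
  zero_at_infty' := by
    intro s hs
    obtain ⟨K, hK, h⟩ := mem_cocompact.mp (zero_at_infty b hs)
    refine mem_map.mpr (mem_cocompact.mpr ⟨mk N '' K, hK.image (continuous_mk N), fun y hy => ?_⟩)
    obtain ⟨x, rfl⟩ := mk_surjective N y
    exact h fun hx => hy ⟨x, hx, rfl⟩

end OrbitSpace

attribute [local instance] Fintype.ofFinite

open HilbertModule

/-! ### Fibres of Hilbert `C₀(X)`-modules -/

section Fibers

variable {W X E : Type*} [Group W] [TopologicalSpace X] [MulAction W X] [ContinuousConstSMul W X]
  [NormedAddCommGroup E] [NormedSpace ℂ E] [HilbertModule C₀(X, ℂ) E]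

/-- The map `ξ ↦ ξ(x)`. -/
def evalFiberₗ (x : X) : E →ₗ[ℂ] Fiber E x :=
  (UniformSpace.Completion.toComplₗᵢ (𝕜 := ℂ) (E := PreFiber E x)).toLinearMap ∘ₗ
    (PreFiber.of x).toLinearMap

theorem inner_evalFiberₗ (x : X) (ξ η : E) :
    inner ℂ (evalFiberₗ x ξ) (evalFiberₗ x η) = (ip ξ η : C₀(X, ℂ)) x :=
  UniformSpace.Completion.inner_coe _ _

theorem norm_sq_evalFiberₗ (x : X) (ξ : E) :
    ‖evalFiberₗ x ξ‖ ^ 2 = ‖(ip ξ ξ : C₀(X, ℂ)) x‖ := by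
  rw [← inner_evalFiberₗ, inner_self_eq_norm_sq_to_K]
  simp

theorem denseRange_evalFiberₗ (x : X) : DenseRange (evalFiberₗ x : E → Fiber E x) :=
  UniformSpace.Completion.denseRange_coe (α := PreFiber E x)

/-- The values `ζ(x)` are dense in the fibre, so they separate its vectors. -/
theorem evalFiberₗ_eq_iff (x : X) (ξ η : E) : evalFiberₗ x ξ = evalFiberₗ x η ↔
    ∀ ζ, (ip ζ ξ : C₀(X, ℂ)) x = (ip ζ η : C₀(X, ℂ)) x := by
  refine ⟨fun h ζ => by rw [← inner_evalFiberₗ, h, inner_evalFiberₗ], fun h => ?_⟩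
  refine (denseRange_evalFiberₗ x).eq_of_inner_right ℂ fun ζ => ?_
  rw [inner_evalFiberₗ, inner_evalFiberₗ, h]

theorem evalFiberₗ_act (x : X) (ξ : E) (b : C₀(X, ℂ)) :
    evalFiberₗ x (act ξ b) = b x • evalFiberₗ x ξ := by
  rw [← map_smul, evalFiberₗ_eq_iff]
  intro ζ
  rw [ip_act_right, ip_smul_right, ZeroAtInftyContinuousMap.mul_apply,
    ZeroAtInftyContinuousMap.smul_apply, smul_eq_mul, mul_comm]

theorem HilbertModule.ext_eval {ξ η : E} (h : ∀ x : X, evalFiberₗ x ξ = evalFiberₗ x η) : ξ = η :=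
  ext_ip C₀(X, ℂ) fun ζ => ZeroAtInftyContinuousMap.ext fun x =>
    (evalFiberₗ_eq_iff x ξ η).mp (h x) ζ

theorem norm_le_of_norm_evalFiberₗ_le (ξ : E) (ε : ℝ) (hε : 0 ≤ ε)
    (h : ∀ x : X, ‖evalFiberₗ x ξ‖ ≤ ε) : ‖ξ‖ ≤ ε := by
  refine abs_le_of_sq_le_sq' ?_ hε |>.2
  rw [norm_sq (B := C₀(X, ℂ))]
  refine (BoundedContinuousFunction.norm_le (f := (ip ξ ξ : C₀(X, ℂ)).toBCF)
    (sq_nonneg ε)).mpr fun x => ?_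
  change ‖(ip ξ ξ : C₀(X, ℂ)) x‖ ≤ _
  rw [← norm_sq_evalFiberₗ]
  exact pow_le_pow_left₀ (norm_nonneg _) (h x) 2

theorem norm_evalFiberₗ_eq_sqrt (x : X) (ξ : E) :
    ‖evalFiberₗ x ξ‖ = √‖(ip ξ ξ : C₀(X, ℂ)) x‖ := by
  rw [← norm_sq_evalFiberₗ, Real.sqrt_sq (norm_nonneg _)]

theorem continuous_norm_evalFiberₗ (ξ : E) : Continuous fun x : X => ‖evalFiberₗ x ξ‖ := by
  simp only [norm_evalFiberₗ_eq_sqrt]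
  exact ((map_continuous (ip ξ ξ : C₀(X, ℂ))).norm).sqrt

theorem tendsto_norm_evalFiberₗ (ξ : E) :
    Tendsto (fun x : X => ‖evalFiberₗ x ξ‖) (cocompact X) (𝓝 0) := by
  simp only [norm_evalFiberₗ_eq_sqrt]
  have h := ((zero_at_infty (ip ξ ξ : C₀(X, ℂ))).norm).sqrt
  simpa using h

/-- An adjointable operator maps vectors vanishing at `x` to vectors vanishing at `x`. -/
theorem Adjointable.evalFiberₗ_eq (k : Adjointable C₀(X, ℂ) E) {x : X} {ξ η : E}
    (h : evalFiberₗ x ξ = evalFiberₗ x η) : evalFiberₗ x (k ξ) = evalFiberₗ x (k η) := by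
  rw [evalFiberₗ_eq_iff] at h ⊢
  intro ζ
  rw [Adjointable.ip_apply_right, Adjointable.ip_apply_right, h]

/-- In the completeness condition, Hilbert spaces of finite dimension may lie in any universe. -/
theorem TwistedAction.CompletenessCondition.appears {γ : TwoCocycle W X} {T : TwistedAction γ E}
    (hT : T.CompletenessCondition) (x : X) {H : Type*} [NormedAddCommGroup H]
    [InnerProductSpace ℂ H] [FiniteDimensional ℂ H]
    (π : ProjRep (MulAction.stabilizer W x) (γ.atStabilizer x) H) (hπ : π.IsIrreducible)
    (hl : T.LiesOver x π) : T.AppearsInContragredient x π := by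
  -- Orthonormal coordinates replace `H` by a Hilbert space in the lowest universe.
  let e : H ≃ₗᵢ[ℂ] EuclideanSpace ℂ (Fin (Module.finrank ℂ H)) := (stdOrthonormalBasis ℂ H).repr
  let π' : ProjRep (MulAction.stabilizer W x) (γ.atStabilizer x)
      (EuclideanSpace ℂ (Fin (Module.finrank ℂ H))) :=
    { toFun := fun g => (e.symm.trans (π.toFun g)).trans e
      map_mul := fun g₁ g₂ v => by
        simp only [LinearIsometryEquiv.trans_apply, LinearIsometryEquiv.symm_apply_apply,
          π.map_mul, map_smul] }
  have hirr : π'.IsIrreducible := by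
    have := hπ.1
    refine ⟨e.symm.toEquiv.nontrivial, fun S hS => ?_⟩
    have h := hπ.2 (S.comap e.toLinearEquiv.toLinearMap) fun g v hv => by
      have := hS g (e v) hv
      simpa [π'] using this
    have hc (S' : Submodule ℂ _) : Submodule.comap e.toLinearEquiv.toLinearMap S' =
        Submodule.orderIsoMapComap e.toLinearEquiv.symm S' :=
      (Submodule.map_equiv_eq_comap_symm e.toLinearEquiv.symm S').symm
    rw [hc] at h
    simpa using h
  obtain ⟨J, hJ⟩ := hT x _ π' hirr fun w c hc h => by
    change e (π.toFun w (e.symm h)) = _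
    rw [hl w c hc, map_smul, e.apply_symm_apply]
  refine ⟨J.comp e.toLinearIsometry, fun w h => ?_⟩
  have := hJ w (e h)
  simpa [π'] using this

end Fibers

/-! ### Inflated twisted actions and their invariant vectors -/

namespace TwistedAction

variable {W X E : Type*} [Group W] [TopologicalSpace X] [MulAction W X] [ContinuousConstSMul W X]
  [NormedAddCommGroup E] [NormedSpace ℂ E] [HilbertModule C₀(X, ℂ) E] {γ : TwoCocycle W X}

theorem norm_U (T : TwistedAction γ E) (w : W) (ξ : E) : ‖T.U w ξ‖ = ‖ξ‖ := by
  refine (sq_eq_sq₀ (norm_nonneg _) (norm_nonneg _)).mp ?_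
  rw [norm_sq (B := C₀(X, ℂ)), norm_sq (B := C₀(X, ℂ)), T.ip_map, norm_alphaC0]

theorem ip_U_apply (T : TwistedAction γ E) (w : W) (ξ η : E) (x : X) :
    (ip (T.U w ξ) (T.U w η) : C₀(X, ℂ)) (w • x) = (ip ξ η : C₀(X, ℂ)) x := by
  rw [T.ip_map, alphaC0_apply, inv_smul_smul]

theorem evalFiberₗ_I (T : TwistedAction γ E) (w : W) (x : X) (h : w • x = x) (ξ : E) :
    T.I w x x h (evalFiberₗ x ξ) = evalFiberₗ x (T.U w ξ) :=
  T.I_evalFiber w x x h ξ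

/-- The cocycle of the twisted action is a constant cocycle `g`, the subgroup `N` acts
untwisted, the operators `I_{n,x}` are trivial for `n ∈ N`, and `g` is, up to a coboundary, lifted
from the quotient by `N`. -/
structure IsInflated (T : TwistedAction γ E) (N : Subgroup W) (g : W → W → Circle) : Prop where
  U_U : ∀ v w ξ, T.U v (T.U w ξ) = star (g v w : ℂ) • T.U (v * w) ξ
  cocycle : ∀ u v w, g v w * g u (v * w) = g u v * g (u * v) w
  one_left : ∀ w, g 1 w = 1
  one_right : ∀ w, g w 1 = 1
  conj_eq : ∀ n ∈ N, ∀ w, g n w = g w (w⁻¹ * n * w)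
  eq_one : ∀ n ∈ N, ∀ m ∈ N, g n m = 1
  eval_eq : ∀ n ∈ N, ∀ x : X, n • x = x → ∀ ξ, evalFiberₗ x (T.U n ξ) = evalFiberₗ x ξ

/-- An element of `N` fixing `x` lies in `W'_x`, so it acts on `E_x` by a scalar, which is `1`. At
`x₀` this covers all of `N`, and since `E_{x₀} ≠ 0` the cocycle values can be read off from products
of operators on that fibre. -/
theorem isInflated (T : TwistedAction γ E) [hfiber : ∀ x : X, Nontrivial (Fiber E x)]
    (hiota : ∀ (x : X) (w : MulAction.stabilizer W x) (c : ℂ), T.ActsByScalar x w c → c = 1)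
    (hconst : ∀ (x y : X) (v w : W), γ.val x v w = γ.val y v w) (N : Subgroup W) [N.Normal]
    (x₀ : X) (hfixed : MulAction.stabilizer W x₀ = ⊤)
    (hscalar : ∀ x : X,
      T.scalarStabilizer x = (MulAction.stabilizer W x : Set W) ∩ (N : Set W)) :
    T.IsInflated N (γ.val x₀) := by
  have hUU : ∀ v w ξ, T.U v (T.U w ξ) = star (γ.val x₀ v w : ℂ) • T.U (v * w) ξ := by
    refine fun v w ξ => ext_ip C₀(X, ℂ) fun ζ => ZeroAtInftyContinuousMap.ext fun x => ?_
    rw [T.map_map, ip_smul_right, ZeroAtInftyContinuousMap.smul_apply, smul_eq_mul, mul_comm,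
      hconst x x₀]
  have heval : ∀ n ∈ N, ∀ x : X, n • x = x → ∀ ξ : E,
      evalFiberₗ x (T.U n ξ) = evalFiberₗ x ξ := by
    intro n hn x hx ξ
    have h1 : n ∈ T.scalarStabilizer x := by rw [hscalar]; exact ⟨hx, hn⟩
    obtain ⟨h, c, hc⟩ := h1
    have h2 := hiota x ⟨n, h⟩ c hc
    subst h2
    have h3 := congrArg (fun L => L (evalFiberₗ x ξ)) hc
    rw [← T.evalFiberₗ_I n x hx]
    simpa using h3
  have hx₀ (w : W) : w • x₀ = x₀ := by
    have h : w ∈ MulAction.stabilizer W x₀ := by rw [hfixed]; trivial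
    exact h
  obtain ⟨ζ, hζ⟩ : ∃ ζ : E, evalFiberₗ x₀ ζ ≠ 0 := by
    by_contra! h
    obtain ⟨v, hv⟩ := exists_ne (0 : Fiber E x₀)
    refine hv (isClosed_singleton.closure_subset_iff.mpr ?_ (denseRange_evalFiberₗ x₀ v))
    rintro _ ⟨ζ, rfl⟩
    exact h ζ
  -- Phases are compared on the nonzero vector `ζ(x₀)`.
  have hcoe {a b : Circle} (w : W) (h : star (a : ℂ) • evalFiberₗ x₀ ζ =
      star (b : ℂ) • evalFiberₗ x₀ ζ) : a = b :=
    Circle.ext (star_injective (smul_left_injective ℂ hζ h))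
  refine ⟨hUU, fun u v w => ?_, fun w => ?_, fun w => ?_, fun n hn w => ?_, fun n hn m hm => ?_,
    heval⟩
  · have h := γ.cocycle u v w x₀
    have h' := hconst (u⁻¹ • x₀) x₀ v w
    simp only [TwoCocycle.val] at h' ⊢
    rwa [h'] at h
  · simp [TwoCocycle.val, γ.one_left]
  · simp [TwoCocycle.val, γ.one_right]
  -- Both `U_n U_w` and `U_w U_{w⁻¹ n w}` are multiples of `U_{nw}`. At `x₀` both reduce to
  -- `I_{w,x₀}`, because `n` and its conjugate act trivially there, so the two multiples agree.
  · obtain ⟨ξ, hξ⟩ := (T.U (n * w)).surjective ζ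
    refine hcoe w ?_
    have h1 : w * (w⁻¹ * n * w) = n * w := by group
    have h2 := hUU n w ξ
    have h3 := hUU w (w⁻¹ * n * w) ξ
    rw [h1] at h3
    rw [hξ] at h2 h3
    rw [← map_smul, ← map_smul, ← h2, ← h3, heval n hn x₀ (hx₀ n), ← T.evalFiberₗ_I w x₀ (hx₀ w),
      ← T.evalFiberₗ_I w x₀ (hx₀ w), heval _ _ x₀ (hx₀ _)]
    simpa using (inferInstance : N.Normal).conj_mem n hn w⁻¹
  -- At `x₀` the operators of `n`, `m` and `n m` are all the identity, so the factor relating `U_n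
  -- U_m` to `U_{nm}` is `1`.
  · obtain ⟨ξ, hξ⟩ := (T.U (n * m)).surjective ζ
    refine hcoe n ?_
    have h2 := hUU n m ξ
    rw [hξ] at h2
    have h3 := heval (n * m) (N.mul_mem hn hm) x₀ (hx₀ _) ξ
    rw [hξ] at h3
    rw [← map_smul, ← h2, heval n hn x₀ (hx₀ n), heval m hm x₀ (hx₀ m), ← h3]
    simp

/-- The vectors fixed by a subgroup. -/
def invariants (T : TwistedAction γ E) (N : Subgroup W) : Submodule ℂ E where
  carrier := {ξ | ∀ n ∈ N, T.U n ξ = ξ}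
  add_mem' h h' n hn := by rw [map_add, h n hn, h' n hn]
  zero_mem' n _ := map_zero _
  smul_mem' z ξ h n hn := by rw [map_smul, h n hn]

/-- Closedness makes the space of invariants complete, as a Hilbert module must be. -/
theorem isClosed_invariants (T : TwistedAction γ E) (N : Subgroup W) :
    IsClosed (T.invariants N : Set E) := by
  have h : (T.invariants N : Set E) = ⋂ n : N, {ξ | T.U n ξ = ξ} := by
    ext ξ
    simp [invariants]
  rw [h]
  exact isClosed_iInter fun n => isClosed_eq (T.continuous_U _) continuous_id

section Invariants

variable {T : TwistedAction γ E} {N : Subgroup W}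

/-- This is what lets inner products of invariant vectors descend to `X/N`. -/
theorem ip_apply_smul_of_mem_invariants {ξ η : E} (hξ : ξ ∈ T.invariants N)
    (hη : η ∈ T.invariants N) {n : W} (hn : n ∈ N) (x : X) :
    (ip ξ η : C₀(X, ℂ)) (n • x) = (ip ξ η : C₀(X, ℂ)) x := by
  have h := T.ip_U_apply n ξ η x
  rwa [hξ n hn, hη n hn] at h

theorem act_mem_invariants {ξ : E} (hξ : ξ ∈ T.invariants N) {b : C₀(X, ℂ)}
    (hb : ∀ n ∈ N, ∀ x, b (n • x) = b x) : act ξ b ∈ T.invariants N := by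
  intro n hn
  rw [T.map_act, hξ n hn]
  congr 1
  ext x
  rw [alphaC0_apply, hb _ (N.inv_mem hn)]

end Invariants

namespace IsInflated

variable {T : TwistedAction γ E} {N : Subgroup W} {g : W → W → Circle}

theorem g_inv (h : T.IsInflated N g) (w : W) : g w⁻¹ w = g w w⁻¹ := by
  have := h.cocycle w w⁻¹ w
  simpa [h.one_left, h.one_right] using this

theorem U_one (h : T.IsInflated N g) (ξ : E) : T.U 1 ξ = ξ := by
  have h1 := h.U_U 1 1 ξ
  rw [h.one_left, mul_one] at h1
  exact (T.U 1).injective (by simpa using h1)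

theorem U_mul (h : T.IsInflated N g) (v w : W) (ξ : E) : T.U (v * w) ξ = (g v w : ℂ) • T.U v (T.U w ξ) := by
  rw [h.U_U, smul_smul]
  simp [Complex.mul_conj]

theorem U_symm (h : T.IsInflated N g) (w : W) (ξ : E) : (T.U w).symm ξ = (g w w⁻¹ : ℂ) • T.U w⁻¹ ξ := by
  rw [LinearEquiv.symm_apply_eq, map_smul, ← h.U_mul, mul_inv_cancel, h.U_one]

theorem U_U_symm (h : T.IsInflated N g) (v w : W) (ξ : E) :
    T.U v ((T.U w).symm ξ) = (g (v * w⁻¹) w : ℂ) • T.U (v * w⁻¹) ξ := by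
  obtain ⟨η, rfl⟩ := (T.U w).surjective ξ
  rw [LinearEquiv.symm_apply_apply, ← h.U_mul, inv_mul_cancel_right]

theorem U_mul_of_mem (h : T.IsInflated N g) {ξ : E} (hξ : ξ ∈ T.invariants N) (w : W) {n : W} (hn : n ∈ N) :
    T.U (w * n) ξ = (g w n : ℂ) • T.U w ξ := by
  rw [h.U_mul, hξ n hn]

variable [hN : N.Normal]

/-- Moving `n` past `w` replaces it by `w⁻¹ n w ∈ N`, and the two phases this produces cancel by
`conj_eq`. Normality alone would not suffice for a twisted action. -/
theorem U_mem (h : T.IsInflated N g) {ξ : E} (hξ : ξ ∈ T.invariants N) (w : W) : T.U w ξ ∈ T.invariants N := by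
  intro n hn
  have hn' : w⁻¹ * n * w ∈ N := by simpa using hN.conj_mem n hn w⁻¹
  have h1 : n * w = w * (w⁻¹ * n * w) := by group
  rw [h.U_U, h1, h.U_mul_of_mem hξ w hn', smul_smul, h.conj_eq n hn w]
  simp [← Complex.normSq_eq_conj_mul_self]

theorem U_symm_mem (h : T.IsInflated N g) {ξ : E} (hξ : ξ ∈ T.invariants N) (w : W) :
    (T.U w).symm ξ ∈ T.invariants N := by
  rw [h.U_symm]
  exact Submodule.smul_mem _ _ (h.U_mem hξ _)

theorem U_mul_of_mem_left (h : T.IsInflated N g) {ξ : E} (hξ : ξ ∈ T.invariants N) (w : W) {n : W} (hn : n ∈ N) :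
    T.U (n * w) ξ = (g n w : ℂ) • T.U w ξ := by
  rw [h.U_mul, h.U_mem hξ w n hn]

variable [Finite W]

/-- Since `g` is `1` on `N × N`, the usual averaging argument applies without phases. -/
theorem sum_U_mem (h : T.IsInflated N g) (ξ : E) : ∑ n : N, T.U n ξ ∈ T.invariants N := by
  intro m hm
  rw [map_sum]
  refine Fintype.sum_equiv (Equiv.mulLeft (⟨m, hm⟩ : N)) _ _ fun n => ?_
  rw [h.U_U, h.eq_one m hm n n.2]
  simp

/-- Every value of a section is a value of an invariant section. -/
theorem exists_mem_invariants_eval_eq (h : T.IsInflated N g) [LocallyCompactSpace X] [T2Space X] (x : X) (ξ : E) :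
    ∃ ξ' ∈ T.invariants N, evalFiberₗ x ξ' = evalFiberₗ x ξ := by
  have _ : DecidablePred fun n : N => (n : W)⁻¹ • x = x := Classical.decPred _
  -- The function `b` is `1` at `x` and `0` on the rest of its `N`-orbit. In the average of `ξ b`
  -- only the `n` fixing `x` contribute at `x`, and each contributes exactly `ξ(x)`.
  obtain ⟨b, hb1, hb0⟩ := exists_zeroAtInfty_apply_eq_ite
    (Set.finite_range fun n : N => (n : W)⁻¹ • x) x
  set s : Finset N := Finset.univ.filter fun n : N => (n : W)⁻¹ • x = x with hs
  have h1 : evalFiberₗ x (∑ n : N, T.U n (act ξ b)) = (s.card : ℂ) • evalFiberₗ x ξ := by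
    rw [map_sum, ← Finset.sum_filter_add_sum_filter_not _ fun n : N => (n : W)⁻¹ • x = x,
      ← hs, Finset.sum_eq_card_nsmul (b := evalFiberₗ x ξ), Finset.sum_eq_zero, add_zero,
      Nat.cast_smul_eq_nsmul]
    · intro n hn
      rw [T.map_act, evalFiberₗ_act, alphaC0_apply, hb0 _ ⟨n, rfl⟩ (Finset.mem_filter.mp hn).2,
        zero_smul]
    · intro n hn
      have hn' := (Finset.mem_filter.mp hn).2
      rw [T.map_act, evalFiberₗ_act, alphaC0_apply, hn', hb1, one_smul,
        h.eval_eq n n.2 x (inv_smul_eq_iff.mp hn').symm]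
  have hne : (s.card : ℂ) ≠ 0 := by
    rw [Nat.cast_ne_zero]
    exact Finset.card_ne_zero_of_mem (a := (1 : N)) (by simp [hs])
  refine ⟨(s.card : ℂ)⁻¹ • ∑ n : N, T.U n (act ξ b), Submodule.smul_mem _ _ (h.sum_U_mem _), ?_⟩
  rw [map_smul, h1, smul_smul, inv_mul_cancel₀ hne, one_smul]

end IsInflated

end TwistedAction

/-! ### Linear independence of the operators of a complete projective representation -/

/-- The inclusion of a complement of a normal subgroup has a retraction with kernel that subgroup. -/
theorem Subgroup.IsComplement'.exists_retraction {W : Type*} [Group W] {N R : Subgroup W}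
    [N.Normal] (h : Subgroup.IsComplement' N R) :
    ∃ ρ : W →* R, (∀ r : R, ρ r = r) ∧ ∀ w, ρ w = 1 ↔ w ∈ N := by
  have hb : Function.Bijective ((QuotientGroup.mk' N).comp R.subtype) := by
    constructor
    · rw [injective_iff_map_eq_one]
      intro r hr
      have h1 : (r : W) ∈ N := (QuotientGroup.eq_one_iff (r : W)).mp hr
      exact Subtype.ext (Subgroup.disjoint_def.mp h.disjoint h1 r.2)
    · intro q
      obtain ⟨w, rfl⟩ := QuotientGroup.mk'_surjective N q
      obtain ⟨⟨n, r⟩, hnr⟩ := h.2 w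
      refine ⟨r, ?_⟩
      rw [← hnr, map_mul, MonoidHom.comp_apply]
      have : QuotientGroup.mk' N (n : W) = 1 := (QuotientGroup.eq_one_iff _).mpr n.2
      rw [this, one_mul]
      rfl
  refine ⟨(MulEquiv.ofBijective _ hb).symm.toMonoidHom.comp (QuotientGroup.mk' N), fun r => ?_,
    fun w => ?_⟩
  · exact (MulEquiv.ofBijective _ hb).symm_apply_apply r
  · change (MulEquiv.ofBijective _ hb).symm _ = 1 ↔ _
    rw [MulEquiv.map_eq_one_iff]
    exact QuotientGroup.eq_one_iff w

/-- The isometry `a ↦ (r ↦ c(r) a(s⁻¹ r))` of `ℓ²(R)`, for a unimodular function `c`. -/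
def twistedShift {R : Type*} [Group R] [Finite R] (s : R) (c : R → Circle) :
    EuclideanSpace ℂ R →ₗᵢ[ℂ] EuclideanSpace ℂ R where
  toFun a := WithLp.toLp 2 fun r => (c r : ℂ) * a (s⁻¹ * r)
  map_add' a b := by
    ext r
    simp [mul_add]
  map_smul' z a := by
    ext r
    simp only [PiLp.smul_apply, smul_eq_mul, RingHom.id_apply]
    ring
  norm_map' a := by
    change ‖WithLp.toLp 2 fun r => (c r : ℂ) * a (s⁻¹ * r)‖ = ‖a‖
    rw [EuclideanSpace.norm_eq, EuclideanSpace.norm_eq]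
    congr 1
    refine Fintype.sum_equiv (Equiv.mulLeft s⁻¹) _ _ fun r => ?_
    rw [Equiv.coe_mulLeft, norm_mul, Circle.norm_coe, one_mul]

/-! ### The twisted regular representation on `ℓ²(R)` and the relations at a point -/

namespace TwistedAction

variable {W X E : Type*} [Group W] [TopologicalSpace X] [MulAction W X] [ContinuousConstSMul W X]
  [NormedAddCommGroup E] [NormedSpace ℂ E] [HilbertModule C₀(X, ℂ) E] {γ : TwoCocycle W X}

/-- The unimodular function `β` with `U_w ξ = β(w) U_{ρ(w)} ξ` for invariant vectors `ξ`. -/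
def phase {R : Subgroup W} (g : W → W → Circle) (ρ : W →* R) (w : W) : Circle :=
  g (w * (ρ w : W)⁻¹) (ρ w)

namespace IsInflated

variable {T : TwistedAction γ E} {N R : Subgroup W} {g : W → W → Circle} {ρ : W →* R}

theorem mul_retraction_inv_mem (hρ : ∀ r : R, ρ r = r) (hker : ∀ w, ρ w = 1 ↔ w ∈ N) (w : W) :
    w * (ρ w : W)⁻¹ ∈ N := by
  rw [← hker, map_mul, map_inv, hρ, mul_inv_cancel]

theorem phase_of_mem (h : T.IsInflated N g) (hker : ∀ w, ρ w = 1 ↔ w ∈ N) {n : W} (hn : n ∈ N) :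
    phase g ρ n = 1 := by
  rw [phase, (hker n).mpr hn]
  exact h.one_right _

theorem U_eq_phase_smul [N.Normal] (h : T.IsInflated N g) (hρ : ∀ r : R, ρ r = r)
    (hker : ∀ w, ρ w = 1 ↔ w ∈ N) {ξ : E} (hξ : ξ ∈ T.invariants N) (w : W) :
    T.U w ξ = (phase g ρ w : ℂ) • T.U (ρ w) ξ := by
  have h1 := h.U_mul_of_mem_left hξ (ρ w) (mul_retraction_inv_mem hρ hker w)
  rwa [inv_mul_cancel_right] at h1

/-- Computing `U_v U_w ζ` directly and through `R` on one nonzero invariant vector shows that the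
phase is a cochain whose coboundary relates `g` to the inflation of its restriction to `R`. -/
theorem phase_mul [N.Normal] (h : T.IsInflated N g) (hρ : ∀ r : R, ρ r = r)
    (hker : ∀ w, ρ w = 1 ↔ w ∈ N) {ζ : E} (hζ : ζ ∈ T.invariants N) (hζ0 : ζ ≠ 0) (v w : W) :
    g v w * (phase g ρ v * phase g ρ w) = g (ρ v) (ρ w) * phase g ρ (v * w) := by
  have h1 := h.U_U v w ζ
  rw [h.U_eq_phase_smul hρ hker hζ w, map_smul,
    h.U_eq_phase_smul hρ hker (h.U_mem hζ _) v, h.U_U,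
    h.U_eq_phase_smul hρ hker hζ (v * w), smul_smul, smul_smul, smul_smul, map_mul] at h1
  have h2 : T.U ((ρ v * ρ w : R) : W) ζ ≠ 0 := (map_ne_zero_iff _ (T.U _).injective).mpr hζ0
  have h3 := smul_left_injective ℂ h2 h1
  have h4 (z : Circle) : star (z : ℂ) = ((z⁻¹ : Circle) : ℂ) := (Circle.coe_inv_eq_conj z).symm
  rw [h4, h4, ← Circle.coe_mul, ← Circle.coe_mul, ← Circle.coe_mul] at h3
  have h5 : phase g ρ w * (phase g ρ v * (g (ρ v) (ρ w))⁻¹) =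
      (g v w)⁻¹ * phase g ρ (v * w) := by
    rw [← mul_assoc]
    exact Circle.ext h3
  calc g v w * (phase g ρ v * phase g ρ w) = g v w * (phase g ρ w *
        (phase g ρ v * (g (ρ v) (ρ w))⁻¹)) * g (ρ v) (ρ w) := by
        rw [mul_comm (phase g ρ v), ← mul_assoc (phase g ρ w), mul_assoc (g v w),
          inv_mul_cancel_right]
    _ = _ := by rw [h5, mul_inv_cancel_left, mul_comm]

variable [Finite W]

/-- The twisted translation by `w` on `ℓ²(R)`. -/
def translation (g : W → W → Circle) (ρ : W →* R) (w : W) :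
    EuclideanSpace ℂ R →ₗᵢ[ℂ] EuclideanSpace ℂ R :=
  twistedShift (ρ w) fun r => (phase g ρ w)⁻¹ * g (ρ w) ((ρ w)⁻¹ * r : R)

theorem translation_apply (w : W) (a : EuclideanSpace ℂ R) (r : R) : translation g ρ w a r =
    (((phase g ρ w)⁻¹ * g (ρ w) ((ρ w)⁻¹ * r : R) : Circle) : ℂ) * a ((ρ w)⁻¹ * r) := rfl

/-- The left regular representation of `R` twisted by `g`, composed with `ρ`, has the inflated
multiplier; division by the phase turns it into `g` itself, by `phase_mul`. -/
theorem translation_translation [N.Normal] (h : T.IsInflated N g) (hρ : ∀ r : R, ρ r = r)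
    (hker : ∀ w, ρ w = 1 ↔ w ∈ N) {ζ : E} (hζ : ζ ∈ T.invariants N) (hζ0 : ζ ≠ 0) (v w : W)
    (a : EuclideanSpace ℂ R) :
    translation g ρ v (translation g ρ w a) = (g v w : ℂ) • translation g ρ (v * w) a := by
  ext r
  have h1 := h.cocycle (ρ v) (ρ w) ((ρ w)⁻¹ * ((ρ v)⁻¹ * r) : R)
  have h2 := h.phase_mul hρ hker hζ hζ0 v w
  have e1 : (ρ w : W) * ((ρ w)⁻¹ * ((ρ v)⁻¹ * r) : R) = ((ρ v)⁻¹ * r : R) := by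
    simp
  have e2 : (ρ (v * w))⁻¹ * r = (ρ w)⁻¹ * ((ρ v)⁻¹ * r) := by
    rw [map_mul, mul_inv_rev, mul_assoc]
  rw [e1] at h1
  have h4 : g v w = g (ρ v) (ρ w) * phase g ρ (v * w) * (phase g ρ v * phase g ρ w)⁻¹ := by
    rw [← h2, mul_inv_cancel_right]
  have h5 : (phase g ρ v)⁻¹ * g (ρ v) ((ρ v)⁻¹ * r : R) *
      ((phase g ρ w)⁻¹ * g (ρ w) ((ρ w)⁻¹ * ((ρ v)⁻¹ * r) : R)) =
      g v w * ((phase g ρ (v * w))⁻¹ *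
        g ((ρ v : W) * ρ w) ((ρ w)⁻¹ * ((ρ v)⁻¹ * r) : R)) := by
    rw [h4]
    calc _ = (phase g ρ v)⁻¹ * (phase g ρ w)⁻¹ * (g (ρ w) ((ρ w)⁻¹ * ((ρ v)⁻¹ * r) : R) *
          g (ρ v) ((ρ v)⁻¹ * r : R)) := by
            rw [mul_mul_mul_comm, mul_comm (g _ _) (g _ _)]
      _ = _ := by
            rw [h1, mul_inv]
            generalize phase g ρ (v * w) = A
            generalize phase g ρ v = B
            generalize phase g ρ w = C
            generalize g (ρ v) (ρ w) = D
            generalize g _ _ = F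
            rw [mul_comm (D * A), mul_assoc (B⁻¹ * C⁻¹) (D * A), mul_assoc D A,
              mul_inv_cancel_left]
  have h6 := congrArg ((↑) : Circle → ℂ) h5
  rw [PiLp.smul_apply, translation_apply, translation_apply, translation_apply, e2, map_mul,
    smul_eq_mul]
  simp only [Circle.coe_mul, Subgroup.coe_mul] at h6 ⊢
  linear_combination (a ((ρ w)⁻¹ * ((ρ v)⁻¹ * r))) * h6

/-- The functions `a` on `R`, supported in the isotropy group of the orbit of `x`, such that
`∑_r conj(a(r)) U_r` vanishes at `x` on the invariant vectors. -/
def relations (T : TwistedAction γ E) (N R : Subgroup W) [N.Normal] (x : X) :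
    Submodule ℂ (EuclideanSpace ℂ R) where
  carrier := {a | (∀ r : R, r • OrbitSpace.mk N x ≠ OrbitSpace.mk N x → a r = 0) ∧
    ∀ η ∈ T.invariants N, ∑ r : R, star (a r) • evalFiberₗ x (T.U r η) = 0}
  add_mem' {a b} ha hb := ⟨fun r hr => by rw [PiLp.add_apply, ha.1 r hr, hb.1 r hr, add_zero],
    fun η hη => by
      simp only [PiLp.add_apply, star_add, add_smul, Finset.sum_add_distrib, ha.2 η hη, hb.2 η hη,
        add_zero]⟩
  zero_mem' := ⟨fun r _ => rfl, fun η _ => by simp⟩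
  smul_mem' z a ha := ⟨fun r hr => by rw [PiLp.smul_apply, ha.1 r hr, smul_zero],
    fun η hη => by
      simp only [PiLp.smul_apply, star_smul, smul_assoc, ← Finset.smul_sum, ha.2 η hη, smul_zero]⟩

/-- `w` and `ρ(w)` differ by an element of `N`, which is invisible on `X/N`. -/
theorem retraction_smul_mk [N.Normal] (hρ : ∀ r : R, ρ r = r) (hker : ∀ w, ρ w = 1 ↔ w ∈ N) {w : W}
    {x : X} (hw : w • x = x) : ρ w • OrbitSpace.mk N x = OrbitSpace.mk N x := by
  have h1 : OrbitSpace.mk N x = OrbitSpace.mk N ((ρ w : W) • x) := by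
    rw [← OrbitSpace.mk_smul N (mul_retraction_inv_mem hρ hker w) ((ρ w : W) • x), smul_smul,
      inv_mul_cancel_right, hw]
  exact h1.symm

/-- Applying `I_{w,x}` to a relation gives another one: on invariant vectors `U_w U_r` is a phase
times `U_{ρ(w) r}`, and the translation is defined with the conjugate of the inverse phase. The
support condition survives because `ρ(w)` fixes the orbit of `x`. -/
theorem translation_mem_relations [N.Normal] (h : T.IsInflated N g) (hρ : ∀ r : R, ρ r = r)
    (hker : ∀ w, ρ w = 1 ↔ w ∈ N) {w : W} {x : X} (hw : w • x = x) {a : EuclideanSpace ℂ R}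
    (ha : a ∈ relations T N R x) : translation g ρ w a ∈ relations T N R x := by
  have hρx := retraction_smul_mk hρ hker hw
  refine ⟨fun r hr => ?_, fun η hη => ?_⟩
  · rw [translation_apply, ha.1, mul_zero]
    intro h1
    rw [mul_smul, inv_smul_eq_iff, hρx] at h1
    exact hr h1
  · have h1 := congrArg (T.I w x x hw) (ha.2 η hη)
    rw [map_zero, map_sum] at h1
    rw [← h1]
    symm
    refine Fintype.sum_equiv (Equiv.mulLeft (ρ w)) _ _ fun r => ?_
    rw [Equiv.coe_mulLeft, map_smul, evalFiberₗ_I, translation_apply, inv_mul_cancel_left,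
      Subgroup.coe_mul, h.U_mul, h.U_eq_phase_smul hρ hker (h.U_mem hη _) w, map_smul, map_smul,
      smul_smul, smul_smul]
    congr 1
    have h4 (z : Circle) : star (z : ℂ) = ((z⁻¹ : Circle) : ℂ) := (Circle.coe_inv_eq_conj z).symm
    rw [star_mul', h4, mul_right_comm, ← Circle.coe_mul, mul_comm]
    congr 2
    rw [mul_inv, inv_inv, inv_mul_cancel_right]

/-- The adjoint of a relation is a relation. Taking adjoints moves the base point from `x` to `s x`;
on the support of `a` this point lies in `N x`, and inner products of invariant vectors take the
same value at both. -/
theorem star_mem_relations [N.Normal] [LocallyCompactSpace X] [T2Space X] (h : T.IsInflated N g)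
    {x : X} {a : EuclideanSpace ℂ R} (ha : a ∈ relations T N R x) :
    WithLp.toLp 2 (fun r : R => star ((g r (r⁻¹ : R) : ℂ) * a r⁻¹)) ∈ relations T N R x := by
  refine ⟨fun r hr => ?_, fun η hη => ?_⟩
  · change star ((g r (r⁻¹ : R) : ℂ) * a r⁻¹) = 0
    rw [ha.1, mul_zero, star_zero]
    intro h1
    exact hr (inv_smul_eq_iff.mp h1).symm
  · refine (denseRange_evalFiberₗ x).eq_of_inner_right ℂ fun ζ => ?_
    obtain ⟨ξ, hξ, hζ⟩ := h.exists_mem_invariants_eval_eq x ζ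
    have h1 := congrArg (fun v => inner ℂ v (evalFiberₗ x η)) (ha.2 ξ hξ)
    simp only [inner_zero_left, sum_inner] at h1
    rw [inner_zero_right, ← hζ, inner_sum, ← h1]
    refine Fintype.sum_equiv (Equiv.inv R) _ _ fun r => ?_
    obtain ⟨s, rfl⟩ := inv_surjective r
    rw [Equiv.inv_apply, inv_inv, inner_smul_right, inner_smul_left, inner_evalFiberₗ,
      inner_evalFiberₗ]
    change star (star ((g (s⁻¹ : R) (s⁻¹⁻¹ : R) : ℂ) * a s⁻¹⁻¹)) * _ = star (star (a s)) * _
    rw [star_star, star_star, inv_inv]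
    by_cases hs : s • OrbitSpace.mk N x = OrbitSpace.mk N x
    · obtain ⟨n, hn, hnx⟩ := (OrbitSpace.mk_eq_mk_iff N x ((s : W) • x)).mp hs.symm
      have h2 : (ip ξ (T.U (s⁻¹ : R) η) : C₀(X, ℂ)) x =
          star (g s (s⁻¹ : R) : ℂ) * (ip (T.U s ξ) η : C₀(X, ℂ)) x := by
        rw [← T.ip_U_apply s, h.U_U, ip_smul_right, ← hnx, Subgroup.coe_inv, mul_inv_cancel,
          h.U_one, ZeroAtInftyContinuousMap.smul_apply,
          ip_apply_smul_of_mem_invariants (h.U_mem hξ _) hη hn, smul_eq_mul]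
      have h3 : g (s⁻¹ : R) s = g s (s⁻¹ : R) := h.g_inv s
      have h4 : (g s (s⁻¹ : R) : ℂ) * star (g s (s⁻¹ : R) : ℂ) = 1 := by
        simp [Complex.mul_conj]
      rw [h2, h3]
      linear_combination (a s * (ip (T.U s ξ) η : C₀(X, ℂ)) x) * h4
    · rw [ha.1 s hs, mul_zero, zero_mul, zero_mul]

/-- The `γ_x`-representation of `W_x` on an invariant subspace of `ℓ²(R)`. -/
def translationRep [N.Normal] (h : T.IsInflated N g) (hρ : ∀ r : R, ρ r = r)
    (hker : ∀ w, ρ w = 1 ↔ w ∈ N) {ζ : E} (hζ : ζ ∈ T.invariants N) (hζ0 : ζ ≠ 0) {x : X}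
    (hg : ∀ v w, γ.val x v w = g v w) (M : Submodule ℂ (EuclideanSpace ℂ R))
    (hM : ∀ w ∈ MulAction.stabilizer W x, ∀ a ∈ M, translation g ρ w a ∈ M) :
    ProjRep (MulAction.stabilizer W x) (γ.atStabilizer x) M where
  toFun w := LinearIsometry.toLinearIsometryEquiv
    { toLinearMap := (translation g ρ (w : W)).toLinearMap.restrict (hM w w.2)
      norm_map' := fun a => (translation g ρ (w : W)).norm_map a } rfl
  map_mul v w a := by
    refine Subtype.ext ?_
    change translation g ρ (v : W) (translation g ρ (w : W) a) =
      (γ.val x v w : ℂ) • translation g ρ ((v : W) * w) a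
    rw [hg]
    exact h.translation_translation hρ hker hζ hζ0 v w a

/-- The only use of the completeness condition. An irreducible subrepresentation of the relations
would embed antilinearly in `E_x`, so relations would annihilate it; pairing a nonzero `m` in it
with its own adjoint relation contradicts this. -/
theorem relations_eq_bot [N.Normal] [LocallyCompactSpace X] [T2Space X] (h : T.IsInflated N g)
    (hρ : ∀ r : R, ρ r = r) (hker : ∀ w, ρ w = 1 ↔ w ∈ N) (hT : T.CompletenessCondition) {x : X}
    (hg : ∀ v w, γ.val x v w = g v w) [hx : Nontrivial (Fiber E x)]
    (hscalar : ∀ (w : MulAction.stabilizer W x) (c : ℂ),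
      T.ActsByScalar x w c → c = 1 ∧ (w : W) ∈ N) :
    relations T N R x = ⊥ := by
  obtain ⟨ζ, hζ, hζ0⟩ : ∃ ζ ∈ T.invariants N, ζ ≠ 0 := by
    by_contra! h0
    obtain ⟨v, hv⟩ := exists_ne (0 : Fiber E x)
    refine hv (isClosed_singleton.closure_subset_iff.mpr ?_ (denseRange_evalFiberₗ x v))
    rintro _ ⟨ζ, rfl⟩
    obtain ⟨ξ, hξ, hξ'⟩ := h.exists_mem_invariants_eval_eq x ζ
    rw [← hξ', h0 ξ hξ, map_zero]
    rfl
  by_contra hne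
  -- A minimal nonzero invariant subspace exists by finite dimension, and minimality is
  -- irreducibility.
  obtain ⟨M, ⟨⟨hM0, hMK⟩, hMinv⟩, hmin⟩ := IsArtinian.set_has_minimal
    {M : Submodule ℂ (EuclideanSpace ℂ R) | (M ≠ ⊥ ∧ M ≤ relations T N R x) ∧
      ∀ w ∈ MulAction.stabilizer W x, ∀ a ∈ M, translation g ρ w a ∈ M}
    ⟨relations T N R x, ⟨hne, le_rfl⟩, fun w hw a ha =>
      h.translation_mem_relations hρ hker hw ha⟩
  let π := h.translationRep hρ hker hζ hζ0 hg M hMinv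
  have hπ (w : MulAction.stabilizer W x) (a : M) :
      (π.toFun w a : EuclideanSpace ℂ R) = translation g ρ w a := rfl
  have hirr : π.IsIrreducible := by
    refine ⟨Submodule.nontrivial_iff_ne_bot.mpr hM0, fun S hS => ?_⟩
    by_contra! hS'
    refine hmin (S.map M.subtype) ⟨⟨?_, (Submodule.map_subtype_le M S).trans hMK⟩, ?_⟩ ?_
    · exact fun h1 => hS'.1 (Submodule.map_injective_of_injective M.injective_subtype
        (h1.trans (Submodule.map_bot _).symm))
    · rintro w hw _ ⟨a, ha, rfl⟩
      exact ⟨_, hS ⟨w, hw⟩ a ha, rfl⟩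
    · refine lt_of_le_of_ne (Submodule.map_subtype_le M S) fun h1 => hS'.2 ?_
      refine Submodule.map_injective_of_injective M.injective_subtype ?_
      rw [h1, Submodule.map_top, Submodule.range_subtype]
  -- Elements of `W'_x` lie in `N`, where `ρ` and the phase are trivial, so they act on `ℓ²(R)` as
  -- the identity, in agreement with `ι = 1`.
  obtain ⟨J, hJ⟩ := hT.appears x π hirr fun w c hc a => by
    obtain ⟨rfl, hw⟩ := hscalar w c hc
    refine Subtype.ext (PiLp.ext fun r => ?_)
    rw [hπ, translation_apply, h.phase_of_mem hker hw, (hker w).mpr hw]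
    simp [h.one_left]
  -- If `r` fixes the orbit of `x`, some `n ∈ N` brings `r x` back to `x`, and `n r ∈ W_x` lifts
  -- `r`. The default value `1` elsewhere is harmless since `a(r) = 0` there.
  obtain ⟨w, hw⟩ : ∃ w : R → MulAction.stabilizer W x,
      ∀ r : R, r • OrbitSpace.mk N x = OrbitSpace.mk N x → ρ (w r) = r := by
    have h1 (r : R) : ∃ w : MulAction.stabilizer W x,
        r • OrbitSpace.mk N x = OrbitSpace.mk N x → ρ w = r := by
      by_cases hr : r • OrbitSpace.mk N x = OrbitSpace.mk N x
      · obtain ⟨n, hn, hnx⟩ := (OrbitSpace.mk_eq_mk_iff N ((r : W) • x) x).mp hr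
        refine ⟨⟨n * r, by rw [MulAction.mem_stabilizer_iff, mul_smul, hnx]⟩, fun _ => ?_⟩
        rw [map_mul, (hker n).mpr hn, one_mul, hρ]
      · exact ⟨1, fun hr' => absurd hr' hr⟩
    exact ⟨fun r => (h1 r).choose, fun r => (h1 r).choose_spec⟩
  -- Values of invariant vectors are dense in `E_x`, so a relation becomes an identity between
  -- operators `I_{w_r,x}` on the whole fibre. The phases convert `U_r` into `U_{w_r}`.
  have hop (a : EuclideanSpace ℂ R) (ha : a ∈ relations T N R x) (v : Fiber E x) :
      ∑ r : R, (star (a r) * star (phase g ρ (w r) : ℂ)) • T.I (w r : W) x x (w r).2 v = 0 := by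
    have hcont : Continuous fun v : Fiber E x => ∑ r : R,
        (star (a r) * star (phase g ρ (w r) : ℂ)) • T.I (w r : W) x x (w r).2 v :=
      continuous_finsetSum _ fun r _ =>
        (continuous_const_smul _).comp (T.I (w r : W) x x (w r).2).continuous
    refine congrFun ((denseRange_evalFiberₗ x).equalizer hcont continuous_zero ?_) v
    funext ξ
    obtain ⟨η, hη, hηξ⟩ := h.exists_mem_invariants_eval_eq x ξ
    change ∑ r : R, (star (a r) * star (phase g ρ (w r) : ℂ)) •
      T.I (w r : W) x x (w r).2 (evalFiberₗ x ξ) = 0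
    rw [← hηξ, ← ha.2 η hη]
    refine Finset.sum_congr rfl fun r _ => ?_
    have h1 : T.I (w r : W) x x (w r).2 (evalFiberₗ x η) = evalFiberₗ x (T.U (w r) η) :=
      T.evalFiberₗ_I _ x _ η
    by_cases hr : r • OrbitSpace.mk N x = OrbitSpace.mk N x
    · rw [h1, h.U_eq_phase_smul hρ hker hη, hw r hr, map_smul, smul_smul, mul_assoc]
      congr 1
      simp [← Complex.normSq_eq_conj_mul_self]
    · rw [ha.1 r hr, star_zero, zero_mul, zero_smul, zero_smul]
  -- The operator identity is pulled back through the injective `J`, whose antilinearity undoes the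
  -- conjugations, and the resulting vector is evaluated at `1 ∈ R`.
  have hsum (a : EuclideanSpace ℂ R) (ha : a ∈ relations T N R x) (m : M) :
      ∑ r : R, a r * ((g r (r⁻¹ : R) : ℂ) * (m : EuclideanSpace ℂ R) r⁻¹) = 0 := by
    have h1 : J (∑ r : R, (a r * (phase g ρ (w r) : ℂ)) • π.toFun (w r) m) = 0 := by
      rw [map_sum, ← hop a ha (J m)]
      refine Finset.sum_congr rfl fun r _ => ?_
      rw [J.map_smulₛₗ, hJ, map_mul]
      rfl
    have h2 := congrArg (fun b : M => (b : EuclideanSpace ℂ R) 1)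
      ((map_eq_zero_iff J J.injective).mp h1)
    have h3 : (∑ r : R, (a r * (phase g ρ (w r) : ℂ)) • (π.toFun (w r) m : EuclideanSpace ℂ R)) 1
        = 0 := by
      refine (congrArg (fun b : EuclideanSpace ℂ R => b 1) ?_).trans h2
      simp only [Submodule.coe_sum, Submodule.coe_smul]
    rw [WithLp.ofLp_sum, Finset.sum_apply] at h3
    rw [← h3]
    refine Finset.sum_congr rfl fun r _ => ?_
    by_cases hr : r • OrbitSpace.mk N x = OrbitSpace.mk N x
    · rw [hπ, PiLp.smul_apply, translation_apply, hw r hr, mul_one, Circle.coe_mul, smul_eq_mul]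
      have h4 : (phase g ρ (w r) : ℂ) * ((phase g ρ (w r))⁻¹ : Circle) = 1 := by
        rw [← Circle.coe_mul, mul_inv_cancel, Circle.coe_one]
      linear_combination (-(a r * (g r (r⁻¹ : R) : ℂ) * (m : EuclideanSpace ℂ R) r⁻¹)) * h4
    · rw [ha.1 r hr]
      simp
  obtain ⟨m, hm, hm0⟩ := Submodule.exists_mem_ne_zero_of_ne_bot hM0
  -- With `a` the adjoint of `m`, the sum becomes a sum of squared absolute values of the
  -- coordinates of `m`.
  have h1 := hsum _ (h.star_mem_relations (hMK hm)) ⟨m, hm⟩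
  refine hm0 (PiLp.ext fun r => ?_)
  have h2 : ∑ r : R, ((Complex.normSq ((g r (r⁻¹ : R) : ℂ) * m r⁻¹) : ℝ) : ℂ) = 0 := by
    rw [← h1]
    exact Finset.sum_congr rfl fun r _ => Complex.normSq_eq_conj_mul_self
  rw [← Complex.ofReal_sum, Complex.ofReal_eq_zero,
    Finset.sum_eq_zero_iff_of_nonneg fun _ _ => Complex.normSq_nonneg _] at h2
  have h3 := h2 r⁻¹ (Finset.mem_univ _)
  simpa using h3

end IsInflated

end TwistedAction

/-! ### Norm and positivity in crossed products by finite groups -/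

namespace CrossedProduct

variable {G Y : Type*} [Group G] [Finite G] [TopologicalSpace Y] [MulAction G Y]
  [ContinuousConstSMul G Y] {δ : TwoCocycle G Y}

theorem norm_coeff_apply_le (f : CrossedProduct δ) (w : G) (y : Y) : ‖f.coeff w y‖ ≤ ‖f‖ := by
  rw [norm_eq, ← regular_one_right]
  calc ‖(regular f).entry (w⁻¹ • y) w 1‖ ≤ ‖(regular f).toFun (w⁻¹ • y)‖ :=
        CStarMatrix.norm_entry_le_norm (M := (regular f).toFun (w⁻¹ • y))
    _ ≤ ‖regular f‖ := (ZeroAtInftyContinuousMap.toBCF (regular f)).norm_coe_le_norm _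

-- At each point the matrix of the regular representation has entries bounded by the coefficients,
-- and all norms on matrices over a finite index set are equivalent.
variable (δ) in
theorem exists_norm_le : ∃ C : ℝ, 0 ≤ C ∧ ∀ (f : CrossedProduct δ) (ε : ℝ), 0 ≤ ε →
    (∀ w y, ‖f.coeff w y‖ ≤ ε) → ‖f‖ ≤ C * ε := by
  let L : (G → G → ℂ) →ₗ[ℂ] CStarMatrix G G ℂ :=
    { toFun := fun m => CStarMatrix.ofMatrix m
      map_add' := fun _ _ => rfl
      map_smul' := fun _ _ => rfl }
  let L' := LinearMap.toContinuousLinearMap L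
  refine ⟨‖L'‖, L'.opNorm_nonneg, fun f ε hε hf => ?_⟩
  rw [norm_eq]
  refine (BoundedContinuousFunction.norm_le
    (f := ZeroAtInftyContinuousMap.toBCF (regular f)) (by positivity)).mpr fun y => ?_
  refine (L'.le_opNorm fun u v => (regular f).entry y u v).trans ?_
  refine mul_le_mul_of_nonneg_left ?_ L'.opNorm_nonneg
  refine (pi_norm_le_iff_of_nonneg hε).mpr fun u => (pi_norm_le_iff_of_nonneg hε).mpr fun v => ?_
  rw [regular_apply, norm_mul, Circle.norm_coe, mul_one]
  exact hf _ _

/-- Taking the coefficient at `1` is a faithful positive map: for `f⋆ f` the cocycle drops out and a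
sum of squares remains. -/
theorem coeff_one_star_mul_self (f : CrossedProduct δ) (y : Y) :
    (star f * f).coeff 1 y = ∑ w : G, (Complex.normSq (f.coeff w⁻¹ (w⁻¹ • y)) : ℂ) := by
  rw [coeff_mul_apply]
  refine Finset.sum_congr rfl fun w _ => ?_
  have h : star (δ.val y w w⁻¹ : ℂ) * (δ.val y w w⁻¹ : ℂ) = 1 := by
    simp [← Complex.normSq_eq_conj_mul_self]
  rw [coeff_star_apply, mul_one, Complex.normSq_eq_conj_mul_self]
  change _ = star (f.coeff w⁻¹ (w⁻¹ • y)) * _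
  linear_combination (star (f.coeff w⁻¹ (w⁻¹ • y)) * f.coeff w⁻¹ (w⁻¹ • y)) * h

/-- A self-adjoint element of the crossed product is positive if the coefficients at `1` of all
`q⋆ f q` are positive functions. -/
theorem exists_eq_star_mul_self (f : CrossedProduct δ) (hf : star f = f)
    (hpos : ∀ (q : CrossedProduct δ) (y : Y), 0 ≤ ((star q * f * q).coeff 1 y).re) :
    ∃ b, f = star b * b := by
  let _ : PartialOrder (CrossedProduct δ) := CStarAlgebra.spectralOrder _
  have _ : StarOrderedRing (CrossedProduct δ) := CStarAlgebra.spectralOrderedRing _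
  have hsub : f⁺ - f⁻ = f := CFC.posPart_sub_negPart f hf
  have hmul : f⁺ * f⁻ = 0 := CFC.posPart_mul_negPart f
  obtain ⟨s, hs⟩ := CStarAlgebra.nonneg_iff_eq_star_mul_self.mp (CFC.negPart_nonneg f)
  obtain ⟨p, hp⟩ := CStarAlgebra.nonneg_iff_eq_star_mul_self.mp (CFC.posPart_nonneg f)
  generalize hq : f⁻ = q at *
  have hqs : star q = q := by rw [hs, star_mul, star_star]
  -- For the negative part `q = s⋆ s` one has `q f q = -q³ = -(s q)⋆ (s q)`. The hypothesis makes
  -- its coefficient at `1` nonnegative, yet it is minus a sum of squares, so every coefficient of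
  -- `s q` vanishes.
  have hsq : s * q = 0 := by
    have h1 : star q * f * q = -(star (s * q) * (s * q)) := by
      rw [← hsub, mul_sub, sub_mul, mul_assoc, hmul, mul_zero, zero_sub, star_mul, mul_assoc,
        mul_assoc (star q) (star s), ← mul_assoc (star s) s, ← hs]
    refine ext_coeff fun w y => ?_
    have h2 := hpos q (w⁻¹ • y)
    have h3 (F : CrossedProduct δ) (z : Y) : (-F).coeff 1 z = -(F.coeff 1 z) := rfl
    rw [h1, h3, coeff_one_star_mul_self, ← Complex.ofReal_sum, ← Complex.ofReal_neg,
      Complex.ofReal_re, neg_nonneg] at h2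
    have h4 := (Finset.sum_eq_zero_iff_of_nonneg fun _ _ => Complex.normSq_nonneg _).mp
      (le_antisymm h2 (Finset.sum_nonneg fun _ _ => Complex.normSq_nonneg _)) w⁻¹
      (Finset.mem_univ _)
    rw [inv_inv, smul_inv_smul, Complex.normSq_eq_zero] at h4
    exact h4
  have hq0 : q = 0 := by
    rw [← CStarRing.star_mul_self_eq_zero_iff, hqs]
    nth_rewrite 1 [hs]
    rw [mul_assoc, hsq, mul_zero]
  exact ⟨p, hsub.symm.trans (by rw [hq0, sub_zero, hp])⟩

end CrossedProduct

/-! ### The invariant vectors as a Hilbert module over the crossed product -/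

namespace TwistedAction.IsInflated

variable {W X E : Type*} [Group W] [Finite W] [TopologicalSpace X] [MulAction W X]
  [ContinuousConstSMul W X] [NormedAddCommGroup E] [NormedSpace ℂ E] [HilbertModule C₀(X, ℂ) E]
  {γ : TwoCocycle W X} {T : TwistedAction γ E} {N R : Subgroup W} [N.Normal]
  {g : W → W → Circle} (δ : TwoCocycle R (OrbitSpace N X))

theorem ip_sum_apply {ι : Type*} (s : Finset ι) (ξ : E) (η : ι → E) (x : X) :
    (ip ξ (∑ i ∈ s, η i) : C₀(X, ℂ)) x = ∑ i ∈ s, (ip ξ (η i) : C₀(X, ℂ)) x := by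
  simp only [← inner_evalFiberₗ, map_sum, inner_sum]

/-- The inner product with values in the crossed product: `⟨ξ | η⟩ = ∑_r ⟨ξ | U_r η⟩ r`. -/
def crossedIp (h : T.IsInflated N g) (ξ η : T.invariants N) : CrossedProduct δ :=
  CrossedProduct.ofCoeff δ fun r => OrbitSpace.descend N (ip (ξ : E) (T.U r (η : E)))
    fun _ hn x => ip_apply_smul_of_mem_invariants ξ.2 (h.U_mem η.2 r) hn x

theorem pullback_smul (b : C₀(OrbitSpace N X, ℂ)) {n : W} (hn : n ∈ N) (x : X) :
    OrbitSpace.pullback N b (n • x) = OrbitSpace.pullback N b x := by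
  rw [OrbitSpace.pullback_apply, OrbitSpace.mk_smul N hn, OrbitSpace.pullback_apply]

variable {δ}

/-- The right action of the crossed product: `r` acts by `U_r⁻¹`. -/
def crossedAct (h : T.IsInflated N g) (ξ : T.invariants N) (f : CrossedProduct δ) :
    T.invariants N :=
  ⟨∑ r : R, (T.U r).symm (act (ξ : E) (OrbitSpace.pullback N (f.coeff r))),
    Submodule.sum_mem _ fun _ _ => h.U_symm_mem
      (act_mem_invariants ξ.2 fun _ hn x => pullback_smul _ hn x) _⟩

theorem coeff_crossedIp (h : T.IsInflated N g) (ξ η : T.invariants N) (r : R) (x : X) :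
    (h.crossedIp δ ξ η).coeff r (OrbitSpace.mk N x) =
      (ip (ξ : E) (T.U r (η : E)) : C₀(X, ℂ)) x := rfl

theorem ext_coeff_mk {f f' : CrossedProduct δ}
    (hf : ∀ r x, f.coeff r (OrbitSpace.mk N x) = f'.coeff r (OrbitSpace.mk N x)) : f = f' := by
  refine CrossedProduct.ext_coeff fun r y => ?_
  obtain ⟨x, rfl⟩ := OrbitSpace.mk_surjective N y
  exact hf r x

theorem crossedIp_act_right (h : T.IsInflated N g) (hδ : ∀ y r s, δ.val y r s = g r s)
    (ξ η : T.invariants N) (f : CrossedProduct δ) :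
    h.crossedIp δ ξ (h.crossedAct η f) = h.crossedIp δ ξ η * f := by
  refine ext_coeff_mk fun u x => ?_
  rw [coeff_crossedIp, CrossedProduct.coeff_mul_apply]
  change (ip (ξ : E) (T.U u (∑ r : R, _)) : C₀(X, ℂ)) x = _
  rw [map_sum, ip_sum_apply]
  refine Fintype.sum_equiv ((Equiv.inv R).trans (Equiv.mulLeft u)) _ _ fun r => ?_
  have e1 : ((Equiv.inv R).trans (Equiv.mulLeft u)) r = u * r⁻¹ := rfl
  have e2 : (u * r⁻¹)⁻¹ * u = r := by group
  rw [e1, e2, hδ, coeff_crossedIp, h.U_U_symm, T.map_act, ip_smul_right, ip_act_right,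
    ZeroAtInftyContinuousMap.smul_apply, ZeroAtInftyContinuousMap.mul_apply, alphaC0_apply,
    OrbitSpace.pullback_apply, smul_eq_mul]
  exact mul_left_comm _ _ _

theorem star_crossedIp (h : T.IsInflated N g) (hδ : ∀ y r s, δ.val y r s = g r s)
    (ξ η : T.invariants N) : star (h.crossedIp δ ξ η) = h.crossedIp δ η ξ := by
  refine ext_coeff_mk fun u x => ?_
  have e1 : (u⁻¹ : R) • OrbitSpace.mk N x = OrbitSpace.mk N ((u : W)⁻¹ • x) := rfl
  have h1 : star ((ip (ξ : E) (T.U (u⁻¹ : R) η) : C₀(X, ℂ)) ((u : W)⁻¹ • x)) =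
      (g u (u⁻¹ : R) : ℂ) * (ip (η : E) (T.U u ξ) : C₀(X, ℂ)) x := by
    have h2 := T.ip_U_apply u (T.U (u⁻¹ : R) η) ξ ((u : W)⁻¹ • x)
    have h3 := congrArg (fun b : C₀(X, ℂ) => b ((u : W)⁻¹ • x))
      (star_ip (ξ : E) (T.U (u⁻¹ : R) (η : E)))
    refine h3.trans (h2.symm.trans ?_)
    rw [h.U_U, smul_inv_smul, Subgroup.coe_inv, mul_inv_cancel, h.U_one, ip_smul_left, star_star,
      ZeroAtInftyContinuousMap.smul_apply, smul_eq_mul]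
  have h4 : star (g u (u⁻¹ : R) : ℂ) * (g u (u⁻¹ : R) : ℂ) = 1 := by
    simp [← Complex.normSq_eq_conj_mul_self]
  rw [CrossedProduct.coeff_star_apply, hδ, e1, coeff_crossedIp, coeff_crossedIp, h1, ← mul_assoc,
    h4, one_mul]

theorem crossedIp_act_left (h : T.IsInflated N g) (hδ : ∀ y r s, δ.val y r s = g r s)
    (ξ η : T.invariants N) (f : CrossedProduct δ) :
    h.crossedIp δ (h.crossedAct ξ f) η = star f * h.crossedIp δ ξ η := by
  rw [← h.star_crossedIp hδ, h.crossedIp_act_right hδ, star_mul, h.star_crossedIp hδ]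

theorem coeff_one_crossedIp (h : T.IsInflated N g) (ξ η : T.invariants N) (x : X) :
    (h.crossedIp δ ξ η).coeff 1 (OrbitSpace.mk N x) = (ip (ξ : E) (η : E) : C₀(X, ℂ)) x := by
  rw [coeff_crossedIp, Subgroup.coe_one, h.U_one]

variable (δ) in
/-- The invariant vectors with their inner product in the crossed product. -/
def preHilbertModule (h : T.IsInflated N g) (hδ : ∀ y r s, δ.val y r s = g r s) :
    PreHilbertModule (CrossedProduct δ) (T.invariants N) where
  ip := h.crossedIp δ
  act := h.crossedAct
  ip_add_right ξ η ζ := ext_coeff_mk fun r x => by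
    rw [CrossedProduct.coeff_add, ZeroAtInftyContinuousMap.add_apply]
    simp only [coeff_crossedIp, Submodule.coe_add, map_add, ip_add_right]
    rfl
  ip_smul_right z ξ η := ext_coeff_mk fun r x => by
    rw [CrossedProduct.coeff_smul, ZeroAtInftyContinuousMap.smul_apply]
    simp only [coeff_crossedIp, Submodule.coe_smul, map_smul, ip_smul_right]
    rfl
  ip_act_right := h.crossedIp_act_right hδ
  star_ip := h.star_crossedIp hδ
  ip_self_nonneg ξ := by
    -- `q⋆ ⟨ξ | ξ⟩ q = ⟨ξ q | ξ q⟩`, and its coefficient at `1` is the original inner product of `ξ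
    -- q` with itself.
    refine CrossedProduct.exists_eq_star_mul_self _ (h.star_crossedIp hδ ξ ξ) fun q y => ?_
    obtain ⟨x, rfl⟩ := OrbitSpace.mk_surjective N y
    rw [← h.crossedIp_act_left hδ, ← h.crossedIp_act_right hδ, h.coeff_one_crossedIp,
      ← inner_evalFiberₗ]
    exact inner_self_nonneg (𝕜 := ℂ)
  definite ξ hξ := by
    have h1 : (ip (ξ : E) (ξ : E) : C₀(X, ℂ)) = 0 := by
      ext x
      rw [← h.coeff_one_crossedIp (δ := δ), hξ]
      rfl
    have h2 := norm_sq (B := C₀(X, ℂ)) (ξ : E)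
    rw [h1, norm_zero, sq_eq_zero_iff, norm_eq_zero] at h2
    exact Subtype.ext h2

/-- The norm of the Hilbert module over the crossed product is equivalent to that of `E`. -/
theorem exists_norm_crossedIp_bounds (h : T.IsInflated N g) : ∃ C C' : ℝ, ∀ ξ : T.invariants N,
    ‖h.crossedIp δ ξ ξ‖ ≤ C * ‖(ξ : E)‖ ^ 2 ∧ ‖(ξ : E)‖ ^ 2 ≤ C' * ‖h.crossedIp δ ξ ξ‖ := by
  obtain ⟨C, hC0, hC⟩ := CrossedProduct.exists_norm_le δ
  -- The second constant is `1` because the coefficient at `1`, dominated by the norm, already is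
  -- `⟨ξ | ξ⟩`.
  refine ⟨C, 1, fun ξ => ⟨hC _ _ (sq_nonneg _) fun r y => ?_, ?_⟩⟩
  · obtain ⟨x, rfl⟩ := OrbitSpace.mk_surjective N y
    rw [coeff_crossedIp]
    calc _ ≤ ‖(ip (ξ : E) (T.U r (ξ : E)) : C₀(X, ℂ))‖ :=
          (ZeroAtInftyContinuousMap.toBCF _).norm_coe_le_norm x
      _ ≤ ‖(ξ : E)‖ * ‖T.U r (ξ : E)‖ := norm_ip_le _ _ _
      _ = ‖(ξ : E)‖ ^ 2 := by rw [T.norm_U, sq]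
  · rw [one_mul, norm_sq (B := C₀(X, ℂ))]
    refine (BoundedContinuousFunction.norm_le
      (f := (ip (ξ : E) (ξ : E) : C₀(X, ℂ)).toBCF) (norm_nonneg _)).mpr fun x => ?_
    change ‖(ip (ξ : E) (ξ : E) : C₀(X, ℂ)) x‖ ≤ _
    rw [← h.coeff_one_crossedIp (δ := δ)]
    exact CrossedProduct.norm_coeff_apply_le _ _ _

variable [LocallyCompactSpace X] [T2Space X]

/-- The values at a point of the inner products `⟨ξ | η⟩` exhaust the functions on `R`. -/
theorem eq_zero_of_sum_mul_ip_eq_zero (h : T.IsInflated N g) {ρ : W →* R}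
    (hρ : ∀ r : R, ρ r = r) (hker : ∀ w, ρ w = 1 ↔ w ∈ N) (hT : T.CompletenessCondition) {x : X}
    (hg : ∀ v w, γ.val x v w = g v w) [Nontrivial (Fiber E x)]
    (hscalar : ∀ (w : MulAction.stabilizer W x) (c : ℂ),
      T.ActsByScalar x w c → c = 1 ∧ (w : W) ∈ N) (a : R → ℂ)
    (ha : ∀ ξ ∈ T.invariants N, ∀ η ∈ T.invariants N,
      ∑ r : R, a r * (ip ξ (T.U r η) : C₀(X, ℂ)) x = 0) : a = 0 := by
  funext r₀
  set y : OrbitSpace N X := OrbitSpace.mk N x with hy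
  -- To isolate `a(r₀)`, test with `η = U_{r₀}⁻¹ θ · b`, where `b` is `1` at `r₀⁻¹ y` and `0`
  -- elsewhere on the `R`-orbit. Only `r = s r₀` with `s` fixing `y` survive, so the coefficients
  -- form a relation at `x`; its value at `s = 1` is `conj a(r₀)`.
  obtain ⟨b, hb1, hb0⟩ := exists_zeroAtInfty_apply_eq_ite
    (Set.finite_range fun r : R => r • y) (r₀⁻¹ • y)
  have hmem : WithLp.toLp 2 (fun s : R => star (a (s * r₀) * (g s r₀ : ℂ) *
      b ((s * r₀)⁻¹ • y))) ∈ relations T N R x := by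
    refine ⟨fun s hs => ?_, fun θ hθ => ?_⟩
    · change star (a (s * r₀) * (g s r₀ : ℂ) * b ((s * r₀)⁻¹ • y)) = 0
      rw [hb0 _ ⟨_, rfl⟩, mul_zero, star_zero]
      intro h1
      have h2 : r₀⁻¹ • s⁻¹ • y = r₀⁻¹ • y := by rwa [← mul_smul, ← mul_inv_rev]
      exact hs (inv_smul_eq_iff.mp (MulAction.injective r₀⁻¹ h2)).symm
    · refine (denseRange_evalFiberₗ x).eq_of_inner_right ℂ fun ζ => ?_
      obtain ⟨ξ, hξ, hζ⟩ := h.exists_mem_invariants_eval_eq x ζ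
      rw [inner_zero_right, ← hζ, inner_sum, ← ha ξ hξ
        (act ((T.U r₀).symm θ) (OrbitSpace.pullback N b)) (act_mem_invariants
          (h.U_symm_mem hθ _) fun _ hn x => pullback_smul _ hn x)]
      refine Fintype.sum_equiv (Equiv.mulRight r₀) _ _ fun s => ?_
      have e1 : ((s * r₀ : R) : W) * (r₀ : W)⁻¹ = s := by simp
      have e2 : OrbitSpace.mk N (((s * r₀ : R) : W)⁻¹ • x) = (s * r₀)⁻¹ • y := rfl
      rw [inner_smul_right, inner_evalFiberₗ, Equiv.coe_mulRight, T.map_act, h.U_U_symm, e1,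
        ip_act_right, ip_smul_right, ZeroAtInftyContinuousMap.mul_apply,
        ZeroAtInftyContinuousMap.smul_apply, alphaC0_apply, OrbitSpace.pullback_apply, e2,
        smul_eq_mul]
      change star (star (a (s * r₀) * (g s r₀ : ℂ) * b ((s * r₀)⁻¹ • y))) * _ = _
      rw [star_star]
      ring
  rw [h.relations_eq_bot hρ hker hT hg hscalar, Submodule.mem_bot] at hmem
  have h1 : star (a (1 * r₀) * (g (1 : R) r₀ : ℂ) * b ((1 * r₀)⁻¹ • y)) = 0 :=
    congrArg (fun v : EuclideanSpace ℂ R => v 1) hmem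
  rw [one_mul, hb1, Subgroup.coe_one, h.one_left] at h1
  simpa using h1

/-- The crossed product is viewed as sections over `X/N` with fibre `ℂ^R`. The span is stable under
multiplication by functions, and a functional vanishing on its values at a point is zero, so the
partition-of-unity criterion applies. -/
theorem dense_span_crossedIp (h : T.IsInflated N g) {ρ : W →* R}
    (hρ : ∀ r : R, ρ r = r) (hker : ∀ w, ρ w = 1 ↔ w ∈ N) (hT : T.CompletenessCondition)
    (hg : ∀ x v w, γ.val x v w = g v w) (hfiber : ∀ x : X, Nontrivial (Fiber E x))
    (hscalar : ∀ (x : X) (w : MulAction.stabilizer W x) (c : ℂ),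
      T.ActsByScalar x w c → c = 1 ∧ (w : W) ∈ N) :
    Dense (Submodule.span ℂ {f | ∃ ξ η : T.invariants N, f = h.crossedIp δ ξ η} :
      Set (CrossedProduct δ)) := by
  let ev (y : OrbitSpace N X) : CrossedProduct δ →ₗ[ℂ] (R → ℂ) :=
    { toFun := fun f r => f.coeff r y
      map_add' := fun f f' => rfl
      map_smul' := fun z f => rfl }
  have hev (y : OrbitSpace N X) (f : CrossedProduct δ) (r : R) : ev y f r = f.coeff r y := rfl
  obtain ⟨C, hC0, hC⟩ := CrossedProduct.exists_norm_le δ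
  have hcont (f : CrossedProduct δ) : Continuous fun y => ev y f :=
    continuous_pi fun r => map_continuous (f.coeff r)
  refine dense_of_forall_exists_eval_eq ev C (fun f ε hε hf => hC f ε hε fun r y => ?_)
    (fun f => (hcont f).norm) (fun f => ?_)
    (fun b f => CrossedProduct.ofCoeff δ fun r => b * f.coeff r) (fun b f y => rfl) _ ?_ ?_
  · exact (norm_le_pi_norm (ev y f) r).trans (hf y)
  · rw [← tendsto_zero_iff_norm_tendsto_zero]
    exact tendsto_pi_nhds.mpr fun r => zero_at_infty (f.coeff r)
  · intro b f hf
    induction hf using Submodule.span_induction with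
    | mem f hf =>
      obtain ⟨ξ, η, rfl⟩ := hf
      refine Submodule.subset_span ⟨⟨act (ξ : E) (OrbitSpace.pullback N (star b)),
        act_mem_invariants ξ.2 fun _ hn x => pullback_smul _ hn x⟩, η, ?_⟩
      refine ext_coeff_mk fun r x => ?_
      rw [coeff_crossedIp, ip_act_left]
      change b (OrbitSpace.mk N x) * _ = star (star (b (OrbitSpace.mk N x))) * _
      rw [star_star]
      rfl
    | zero =>
      convert Submodule.zero_mem _
      exact CrossedProduct.ext_coeff fun r y => mul_zero _
    | add f f' _ _ hf hf' =>
      convert Submodule.add_mem _ hf hf'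
      exact CrossedProduct.ext_coeff fun r y => mul_add _ _ _
    | smul z f _ hf =>
      convert Submodule.smul_mem _ z hf
      exact CrossedProduct.ext_coeff fun r y => mul_left_comm _ _ _
  · intro y f
    suffices hS : (Submodule.span ℂ {f | ∃ ξ η : T.invariants N, f = h.crossedIp δ ξ η}).map (ev y)
        = ⊤ by
      have h1 : ev y f ∈ (⊤ : Submodule ℂ (R → ℂ)) := trivial
      rw [← hS] at h1
      exact h1
    by_contra hS
    obtain ⟨φ, hφ0, hφ⟩ := Submodule.exists_le_ker_of_lt_top _ (lt_top_iff_ne_top.mpr hS)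
    have _ : DecidableEq R := Classical.decEq _
    have hφe (v : R → ℂ) : φ v = ∑ r : R, φ (Pi.single r 1) * v r := by
      conv_lhs => rw [pi_eq_sum_univ' v, map_sum]
      simp only [map_smul, smul_eq_mul, mul_comm]
    obtain ⟨x, rfl⟩ := OrbitSpace.mk_surjective N y
    have := hfiber x
    have ha := h.eq_zero_of_sum_mul_ip_eq_zero hρ hker hT (hg x) (hscalar x)
      (fun r => φ (Pi.single r 1)) fun ξ hξ η hη => by
        have h1 : φ (ev (OrbitSpace.mk N x) (h.crossedIp δ ⟨ξ, hξ⟩ ⟨η, hη⟩)) = 0 :=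
          hφ (Submodule.mem_map_of_mem (Submodule.subset_span ⟨_, _, rfl⟩))
        rw [hφe] at h1
        exact h1
    refine hφ0 (LinearMap.ext fun v => ?_)
    rw [hφe]
    exact Finset.sum_eq_zero fun r _ => by
      have h1 : φ (Pi.single r 1) = 0 := congrFun ha r
      rw [h1, zero_mul]

end TwistedAction.IsInflated

/-! ### The algebra of invariant compact operators -/

section Ketbra

variable {B E : Type*} [NonUnitalCStarAlgebra B] [NormedAddCommGroup E] [NormedSpace ℂ E]
  [HilbertModule B E]

theorem HilbertModule.norm_ketbra_le (ξ η : E) : ‖ketbra B ξ η‖ ≤ ‖η‖ * ‖ξ‖ := by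
  refine ContinuousLinearMap.opNorm_le_bound _ (by positivity) fun ζ => ?_
  calc ‖act ξ (ip (B := B) η ζ)‖ ≤ ‖ξ‖ * (‖η‖ * ‖ζ‖) :=
        (norm_act_le B _ _).trans (by gcongr; exact norm_ip_le B η ζ)
    _ = _ := by ring

variable (B) in
/-- The bounded linear map `ξ ↦ |ξ⟩⟨η|`. -/
def HilbertModule.ketbraL (η : E) : E →L[ℂ] Adjointable B E :=
  LinearMap.mkContinuous
    { toFun := fun ξ => ketbra B ξ η
      map_add' := fun ξ ξ' => Adjointable.ext fun ζ => by
        simp only [Adjointable.add_apply, ketbra_apply, add_act]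
      map_smul' := fun z ξ => Adjointable.ext fun ζ => by
        simp only [RingHom.id_apply, Adjointable.smul_apply, ketbra_apply, smul_act] }
    ‖η‖ fun ξ => norm_ketbra_le ξ η

theorem HilbertModule.ketbraL_apply (η ξ : E) : ketbraL B η ξ = ketbra B ξ η := rfl

theorem HilbertModule.ketbra_act_right (ξ η : E) (b : B) :
    ketbra B ξ (act η b) = ketbra B (act ξ (star b)) η :=
  Adjointable.ext fun ζ => by rw [ketbra_apply, ketbra_apply, ip_act_left, act_mul]

/-- Phases cancel in rank-one operators, so the twist is invisible on operators. -/
theorem HilbertModule.ketbra_circle_smul (z : Circle) (ξ η : E) :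
    ketbra B ((z : ℂ) • ξ) ((z : ℂ) • η) = ketbra B ξ η :=
  Adjointable.ext fun ζ => by
    rw [ketbra_apply, ketbra_apply, ip_smul_left, act_smul, smul_act, smul_smul]
    simp [← Complex.normSq_eq_conj_mul_self]

theorem HilbertModule.ketbra_mem_compacts (ξ η : E) : ketbra B ξ η ∈ compacts B E :=
  subset_closure (Submodule.subset_span ⟨ξ, η, rfl⟩)

end Ketbra

/-! ### Averaging of compact operators and restriction to invariant vectors -/

namespace TwistedAction

variable {W X E : Type*} [Group W] [TopologicalSpace X] [MulAction W X]
  [ContinuousConstSMul W X] [NormedAddCommGroup E] [NormedSpace ℂ E] [HilbertModule C₀(X, ℂ) E]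
  {γ : TwoCocycle W X} (T : TwistedAction γ E)

theorem U_ketbra (w : W) (ξ η ζ : E) : T.U w (ketbra C₀(X, ℂ) ξ η ζ) =
    ketbra C₀(X, ℂ) (T.U w ξ) (T.U w η) (T.U w ζ) := by
  rw [ketbra_apply, ketbra_apply, T.map_act, T.ip_map]

/-- The operator `U_w` as a linear isometry. -/
def isometryU (w : W) : E ≃ₗᵢ[ℂ] E := ⟨T.U w, T.norm_U w⟩

/-- The operator `U_w k U_w⁻¹`. -/
def conjU (w : W) : Adjointable C₀(X, ℂ) E →L[ℂ] Adjointable C₀(X, ℂ) E :=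
  LinearMap.mkContinuous
    { toFun := fun k => Adjointable.mk
        ((T.isometryU w : E →L[ℂ] E) ∘L k.toCLM ∘L ((T.isometryU w).symm : E →L[ℂ] E))
        ((T.isometryU w : E →L[ℂ] E) ∘L (star k).toCLM ∘L ((T.isometryU w).symm : E →L[ℂ] E))
        fun ξ η => by
          obtain ⟨ξ, rfl⟩ := (T.U w).surjective ξ
          obtain ⟨η, rfl⟩ := (T.U w).surjective η
          change ip (T.U w (k ((T.U w).symm (T.U w ξ)))) (T.U w η) =
            (ip (T.U w ξ) (T.U w (star k ((T.U w).symm (T.U w η)))) : C₀(X, ℂ))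
          rw [T.ip_map, T.ip_map, LinearEquiv.symm_apply_apply, LinearEquiv.symm_apply_apply,
            Adjointable.ip_apply_left]
      map_add' := fun k l => Adjointable.ext fun ξ => (T.U w).map_add _ _
      map_smul' := fun z k => Adjointable.ext fun ξ => (T.U w).map_smul _ _ }
    1 fun k => by
      refine ContinuousLinearMap.opNorm_le_bound _ (by positivity) fun ξ => ?_
      change ‖T.U w (k ((T.isometryU w).symm ξ))‖ ≤ _
      rw [T.norm_U, one_mul, ← (T.isometryU w).symm.norm_map ξ]
      exact k.toCLM.le_opNorm _

theorem conjU_apply_U (w : W) (k : Adjointable C₀(X, ℂ) E) (ξ : E) :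
    T.conjU w k (T.U w ξ) = T.U w (k ξ) :=
  congrArg (fun η => T.U w (k η)) ((T.U w).symm_apply_apply ξ)

theorem conjU_ketbra (w : W) (ξ η : E) : T.conjU w (ketbra C₀(X, ℂ) ξ η) =
    ketbra C₀(X, ℂ) (T.U w ξ) (T.U w η) :=
  Adjointable.ext fun ζ => by
    obtain ⟨ζ, rfl⟩ := (T.U w).surjective ζ
    rw [conjU_apply_U, U_ketbra]

theorem conjU_of_mem_fixedCompacts {k : Adjointable C₀(X, ℂ) E} (hk : k ∈ T.fixedCompacts)
    (w : W) : T.conjU w k = k :=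
  Adjointable.ext fun ζ => by
    obtain ⟨ζ, rfl⟩ := (T.U w).surjective ζ
    rw [conjU_apply_U, hk.2]

namespace IsInflated

variable {T} [Finite W] {N R : Subgroup W} [N.Normal]
  {g : W → W → Circle} {δ : TwoCocycle R (OrbitSpace N X)}

/-- The invariant operator `∑_r |U_r ξ⟩⟨U_r η|`. -/
def sumKetbra (T : TwistedAction γ E) (R : Subgroup W) (ξ η : E) : Adjointable C₀(X, ℂ) E :=
  ∑ r : R, ketbra C₀(X, ℂ) (T.U r ξ) (T.U r η)

theorem sumKetbra_apply (ξ η ζ : E) :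
    sumKetbra T R ξ η ζ = ∑ r : R, ketbra C₀(X, ℂ) (T.U r ξ) (T.U r η) ζ := by
  let L : Adjointable C₀(X, ℂ) E →ₗ[ℂ] E :=
    { toFun := fun k => k ζ
      map_add' := fun _ _ => rfl
      map_smul' := fun _ _ => rfl }
  exact map_sum L _ _

/-- On invariant vectors `U_w U_r` is `U_{ρ(w) r}` up to a phase that does not depend on the vector.
Hence `w` permutes the summands, although the sum runs only over `R`. -/
theorem sumKetbra_mem (h : T.IsInflated N g) {ρ : W →* R}
    (hρ : ∀ r : R, ρ r = r) (hker : ∀ w, ρ w = 1 ↔ w ∈ N) {ξ η : E} (hξ : ξ ∈ T.invariants N)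
    (hη : η ∈ T.invariants N) : sumKetbra T R ξ η ∈ T.fixedCompacts := by
  refine ⟨sum_mem fun r _ => ketbra_mem_compacts _ _, fun w ζ => ?_⟩
  rw [sumKetbra_apply, sumKetbra_apply, map_sum]
  refine Fintype.sum_equiv (Equiv.mulLeft (ρ w)) _ _ fun r => ?_
  have h1 (θ : E) (hθ : θ ∈ T.invariants N) : T.U w (T.U r θ) =
      ((phase g ρ w * (g (ρ w) r)⁻¹ : Circle) : ℂ) • T.U (ρ w * r : R) θ := by
    rw [h.U_eq_phase_smul hρ hker (h.U_mem hθ r), h.U_U, smul_smul, Circle.coe_mul,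
      Circle.coe_inv_eq_conj]
    rfl
  rw [U_ketbra, h1 ξ hξ, h1 η hη, ketbra_circle_smul, Equiv.coe_mulLeft]

variable {F : Type*} [NormedAddCommGroup F] [NormedSpace ℂ F] [HilbertModule (CrossedProduct δ) F]
  (e : T.invariants N ≃L[ℂ] F)

/-- The restriction of an invariant operator to the invariant vectors. -/
def restrictInvariants (k : T.fixedCompacts) : T.invariants N →L[ℂ] T.invariants N :=
  (k.1.toCLM ∘L (T.invariants N).subtypeL).codRestrict (T.invariants N) fun ξ n hn => by
    change T.U n (k.1 (ξ : E)) = k.1 (ξ : E)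
    rw [k.2.2, ξ.2 n hn]

theorem coe_restrictInvariants (k : T.fixedCompacts) (ξ : T.invariants N) :
    (restrictInvariants k ξ : E) = k.1 ξ := rfl

/-- The restriction to the invariant vectors, as a homomorphism to the adjointable operators on the
Hilbert module over the crossed product. -/
def restrictHom (h : T.IsInflated N g)
    (hip : ∀ ξ η : T.invariants N, ip (e ξ) (e η) = h.crossedIp δ ξ η) :
    T.fixedCompacts →⋆ₙₐ[ℂ] Adjointable (CrossedProduct δ) F :=
  have hadj (k : T.fixedCompacts) (ξ η : F) :
      ip (B := CrossedProduct δ) (e (restrictInvariants k (e.symm ξ))) η =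
        ip ξ (e (restrictInvariants (star k) (e.symm η))) := by
    obtain ⟨ξ, rfl⟩ := e.surjective ξ
    obtain ⟨η, rfl⟩ := e.surjective η
    rw [e.symm_apply_apply, e.symm_apply_apply, hip, hip]
    refine ext_coeff_mk fun r x => ?_
    rw [coeff_crossedIp, coeff_crossedIp, coe_restrictInvariants, coe_restrictInvariants,
      Adjointable.ip_apply_left, (star k).2.2]
    rfl
  { toFun := fun k => Adjointable.mk
      ((e : T.invariants N →L[ℂ] F) ∘L restrictInvariants k ∘L (e.symm : F →L[ℂ] T.invariants N))
      ((e : T.invariants N →L[ℂ] F) ∘L restrictInvariants (star k) ∘L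
        (e.symm : F →L[ℂ] T.invariants N)) (hadj k)
    map_smul' := fun z k => Adjointable.ext fun ξ => e.map_smul z (restrictInvariants k (e.symm ξ))
    map_zero' := Adjointable.ext fun ξ => e.map_zero
    map_add' := fun k l => Adjointable.ext fun ξ =>
      e.map_add (restrictInvariants k (e.symm ξ)) (restrictInvariants l (e.symm ξ))
    map_mul' := fun k l => Adjointable.ext fun ξ => by
      change e (restrictInvariants k (restrictInvariants l (e.symm ξ))) =
        e (restrictInvariants k (e.symm (e (restrictInvariants l (e.symm ξ)))))
      rw [e.symm_apply_apply]
    map_star' := fun k => Adjointable.eq_star_of_ip fun ξ η => hadj k ξ η }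

theorem restrictHom_apply (h : T.IsInflated N g)
    (hip : ∀ ξ η : T.invariants N, ip (e ξ) (e η) = h.crossedIp δ ξ η) (k : T.fixedCompacts)
    (ξ : T.invariants N) : h.restrictHom e hip k (e ξ) = e (restrictInvariants k ξ) :=
  congrArg (fun η => e (restrictInvariants k η)) (e.symm_apply_apply ξ)

/-- With `s = r⁻¹`, the term of `r` applied to an invariant `ζ` is `U_s⁻¹(ξ ⟨η | U_s ζ⟩)`, which is
the term of `s` in the crossed product action of `⟨η | ζ⟩` on `ξ`. -/
theorem restrictHom_sumKetbra (h : T.IsInflated N g) (hδ : ∀ y r s, δ.val y r s = g r s)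
    {ρ : W →* R} (hρ : ∀ r : R, ρ r = r) (hker : ∀ w, ρ w = 1 ↔ w ∈ N)
    (hip : ∀ ξ η : T.invariants N, ip (e ξ) (e η) = h.crossedIp δ ξ η) (ξ η : T.invariants N) :
    h.restrictHom e hip ⟨_, h.sumKetbra_mem hρ hker ξ.2 η.2⟩ =
      ketbra (CrossedProduct δ) (e ξ) (e η) := by
  have hact (ξ : T.invariants N) (f : CrossedProduct δ) : act (e ξ) f = e (h.crossedAct ξ f) :=
    ext_ip (CrossedProduct δ) fun ζ => by
      obtain ⟨ζ, rfl⟩ := e.surjective ζ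
      rw [ip_act_right, hip, hip, h.crossedIp_act_right hδ]
  refine Adjointable.ext fun ζ => ?_
  obtain ⟨ζ, rfl⟩ := e.surjective ζ
  rw [restrictHom_apply, ketbra_apply, hip, hact]
  congr 1
  refine Subtype.ext ?_
  change sumKetbra T R (ξ : E) (η : E) (ζ : E) = ∑ r : R, _
  rw [sumKetbra_apply]
  refine Fintype.sum_equiv (Equiv.inv R) _ _ fun r => ?_
  obtain ⟨s, rfl⟩ := inv_surjective r
  have h1 : OrbitSpace.pullback N ((h.crossedIp δ η ζ).coeff s) =
      (ip (η : E) (T.U s (ζ : E)) : C₀(X, ℂ)) := rfl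
  have h2 (θ : E) : T.U s (T.U (s⁻¹ : R) θ) = (((g s (s⁻¹ : R))⁻¹ : Circle) : ℂ) • θ := by
    rw [h.U_U, Subgroup.coe_inv, mul_inv_cancel, h.U_one, Circle.coe_inv_eq_conj]
    rfl
  rw [Equiv.inv_apply, inv_inv, h1, LinearEquiv.eq_symm_apply, U_ketbra, h2, h2,
    ketbra_circle_smul, ketbra_apply]

variable [LocallyCompactSpace X] [T2Space X]

/-- Adjointable operators act fibrewise, and invariant vectors take all values that vectors of `E`
take. -/
theorem restrictHom_injective (h : T.IsInflated N g)
    (hip : ∀ ξ η : T.invariants N, ip (e ξ) (e η) = h.crossedIp δ ξ η) :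
    Function.Injective (h.restrictHom e hip) := by
  rw [injective_iff_map_eq_zero]
  intro k hk
  refine Subtype.ext (Adjointable.ext fun ξ => HilbertModule.ext_eval fun x : X => ?_)
  obtain ⟨ξ', hξ', hx⟩ := h.exists_mem_invariants_eval_eq x ξ
  have h1 : e (restrictInvariants k ⟨ξ', hξ'⟩) = 0 := by
    rw [← h.restrictHom_apply e hip, hk]
    rfl
  have h2 : k.1 ξ' = 0 := congrArg Subtype.val ((map_eq_zero_iff e e.injective).mp h1)
  rw [← Adjointable.evalFiberₗ_eq k.1 hx, h2]
  rfl

theorem dense_span_act_invariants (h : T.IsInflated N g) :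
    Dense (Submodule.span ℂ {ξ : E | ∃ η ∈ T.invariants N, ∃ b : C₀(X, ℂ), ξ = act η b} :
      Set E) := by
  refine dense_of_forall_exists_eval_eq (A := fun x : X => Fiber E x)
    (fun x : X => evalFiberₗ x) 1 (fun ξ ε hε hξ => ?_) (continuous_norm_evalFiberₗ (X := X))
    (tendsto_norm_evalFiberₗ (X := X)) (fun b ξ => act ξ b)
    (fun b ξ x => evalFiberₗ_act x ξ b) _ ?_ fun x ξ => ?_
  · rw [one_mul]
    exact norm_le_of_norm_evalFiberₗ_le ξ ε hε hξ
  · intro b ξ hξ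
    induction hξ using Submodule.span_induction with
    | mem ξ hξ =>
      obtain ⟨η, hη, c, rfl⟩ := hξ
      exact Submodule.subset_span ⟨η, hη, c * b, (act_mul η c b).symm⟩
    | zero =>
      have h0 : act (0 : E) b = 0 := by simpa using smul_act (0 : ℂ) (0 : E) b
      rw [h0]
      exact Submodule.zero_mem _
    | add ξ η _ _ hξ hη =>
      rw [add_act]
      exact Submodule.add_mem _ hξ hη
    | smul z ξ _ hξ =>
      rw [smul_act]
      exact Submodule.smul_mem _ z hξ
  · obtain ⟨η, hη, hx⟩ := h.exists_mem_invariants_eval_eq x ξ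
    obtain ⟨b, hb, -⟩ := exists_zeroAtInfty_apply_eq_ite (Set.finite_empty (α := X)) x
    exact ⟨act η b, Submodule.subset_span ⟨η, hη, b, rfl⟩, by
      rw [evalFiberₗ_act, hb, one_smul, hx]⟩

/-- Averaging over `N` and then `R` sends `|ξ⟩⟨η|` with `η` invariant to an operator `sumKetbra`,
whose restriction has rank one. Density extends this to averages of all compact operators, and
averaging an invariant operator only multiplies it by a nonzero integer. -/
theorem restrictHom_mem_compacts (h : T.IsInflated N g) (hδ : ∀ y r s, δ.val y r s = g r s)
    {ρ : W →* R} (hρ : ∀ r : R, ρ r = r) (hker : ∀ w, ρ w = 1 ↔ w ∈ N)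
    (hip : ∀ ξ η : T.invariants N, ip (e ξ) (e η) = h.crossedIp δ ξ η) (k : T.fixedCompacts) :
    h.restrictHom e hip k ∈ compacts (CrossedProduct δ) F := by
  let Φ := h.restrictHom e hip
  have hΦ : Continuous Φ := (NonUnitalStarAlgHom.isometry Φ (h.restrictHom_injective e hip)).continuous
  let S : Submodule ℂ (Adjointable C₀(X, ℂ) E) :=
    { carrier := {k | ∃ hk : k ∈ T.fixedCompacts, Φ ⟨k, hk⟩ ∈ compacts (CrossedProduct δ) F}
      add_mem' := fun {k l} hk hl => ⟨add_mem hk.1 hl.1, by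
        have := add_mem hk.2 hl.2
        rwa [← map_add] at this⟩
      zero_mem' := ⟨zero_mem _, by
        have : Φ 0 ∈ compacts (CrossedProduct δ) F := by
          rw [map_zero]
          exact zero_mem _
        exact this⟩
      smul_mem' := fun z k hk => ⟨SMulMemClass.smul_mem z hk.1, by
        have := SMulMemClass.smul_mem z hk.2
        rwa [← map_smul] at this⟩ }
  -- The set `S` is closed because restriction is continuous and both C⋆-algebras are closed; this
  -- carries the two density arguments below.
  have hS : IsClosed (S : Set (Adjointable C₀(X, ℂ) E)) := by
    have h1 : (S : Set (Adjointable C₀(X, ℂ) E)) =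
        Subtype.val '' (Φ ⁻¹' (compacts (CrossedProduct δ) F : Set _)) := by
      ext k
      constructor
      · rintro ⟨hk, hk'⟩
        exact ⟨⟨k, hk⟩, hk', rfl⟩
      · rintro ⟨k, hk, rfl⟩
        exact ⟨k.2, hk⟩
    have h2 : IsClosed (T.fixedCompacts : Set (Adjointable C₀(X, ℂ) E)) := inferInstance
    have h3 : IsClosed (compacts (CrossedProduct δ) F : Set (Adjointable (CrossedProduct δ) F)) :=
      inferInstance
    rw [h1]
    exact h2.isClosedEmbedding_subtypeVal.isClosedMap _ (h3.preimage hΦ)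
  let av : Adjointable C₀(X, ℂ) E →L[ℂ] Adjointable C₀(X, ℂ) E :=
    (∑ r : R, T.conjU r) ∘L (∑ n : N, T.conjU n)
  have h1 (ξ : E) {η : E} (hη : η ∈ T.invariants N) : av (ketbra C₀(X, ℂ) ξ η) ∈ S := by
    have h2 : (∑ n : N, T.conjU n) (ketbra C₀(X, ℂ) ξ η) =
        ketbra C₀(X, ℂ) (∑ n : N, T.U n ξ) η := by
      rw [sum_apply, ← ketbraL_apply η (∑ n : N, T.U n ξ), map_sum]
      refine Finset.sum_congr rfl fun n _ => ?_
      rw [ketbraL_apply, conjU_ketbra, hη n n.2]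
    have h3 : av (ketbra C₀(X, ℂ) ξ η) = sumKetbra T R (∑ n : N, T.U n ξ) η := by
      change (∑ r : R, T.conjU r) ((∑ n : N, T.conjU n) (ketbra C₀(X, ℂ) ξ η)) = _
      rw [h2, sum_apply]
      exact Finset.sum_congr rfl fun r _ => T.conjU_ketbra _ _ _
    rw [h3]
    refine ⟨h.sumKetbra_mem hρ hker (h.sum_U_mem ξ) hη, ?_⟩
    have h4 := h.restrictHom_sumKetbra e hδ hρ hker hip ⟨_, h.sum_U_mem ξ⟩ ⟨η, hη⟩
    exact h4 ▸ ketbra_mem_compacts _ _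
  have h2 (ξ η : E) : av (ketbra C₀(X, ℂ) ξ η) ∈ S := by
    have hcont : Continuous fun η : E => av (ketbra C₀(X, ℂ) ξ η) := by
      have h3 : (fun η : E => av (ketbra C₀(X, ℂ) ξ η)) =
          fun η : E => av (star (ketbraL C₀(X, ℂ) ξ η)) := by
        funext η
        rw [ketbraL_apply, star_ketbra]
      rw [h3]
      exact av.continuous.comp (ketbraL C₀(X, ℂ) ξ).continuous.star
    refine (hS.preimage hcont).closure_subset_iff.mpr ?_ (h.dense_span_act_invariants η)
    intro η hη
    change av (ketbra C₀(X, ℂ) ξ η) ∈ S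
    rw [← star_ketbra, ← ketbraL_apply]
    induction hη using Submodule.span_induction with
    | mem η hη =>
      obtain ⟨η, hη, b, rfl⟩ := hη
      -- The function `b` moves to the first vector, which is arbitrary, leaving an invariant second
      -- vector.
      rw [ketbraL_apply, star_ketbra, ketbra_act_right]
      exact h1 _ hη
    | zero =>
      rw [map_zero, star_zero, map_zero]
      exact S.zero_mem
    | add η η' _ _ hη hη' =>
      rw [map_add, star_add, map_add]
      exact S.add_mem hη hη'
    | smul z η _ hη =>
      rw [map_smul, star_smul, map_smul]
      exact S.smul_mem _ hη
  have h3 : av k.1 ∈ S := by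
    refine (hS.preimage av.continuous).closure_subset_iff.mpr ?_ k.2.1
    intro l hl
    change av l ∈ S
    induction hl using Submodule.span_induction with
    | mem l hl =>
      obtain ⟨ξ, η, rfl⟩ := hl
      exact h2 ξ η
    | zero =>
      rw [map_zero]
      exact S.zero_mem
    | add l l' _ _ hl hl' =>
      rw [map_add]
      exact S.add_mem hl hl'
    | smul z l _ hl =>
      rw [map_smul]
      exact S.smul_mem _ hl
  have h4 : av k.1 = ((Fintype.card R * Fintype.card N : ℕ) : ℂ) • k.1 := by
    change (∑ r : R, T.conjU r) ((∑ n : N, T.conjU n) k.1) = _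
    have h5 : (∑ n : N, T.conjU n) k.1 = (Fintype.card N : ℂ) • k.1 := by
      rw [sum_apply]
      simp only [T.conjU_of_mem_fixedCompacts k.2, Finset.sum_const, Finset.card_univ,
        Nat.cast_smul_eq_nsmul]
    rw [h5, map_smul, sum_apply]
    simp only [T.conjU_of_mem_fixedCompacts k.2, Finset.sum_const, Finset.card_univ,
      Nat.cast_smul_eq_nsmul, Nat.cast_mul, mul_smul]
    rw [smul_comm]
  rw [h4] at h3
  have h5 : ((Fintype.card R * Fintype.card N : ℕ) : ℂ) ≠ 0 := by
    rw [Nat.cast_ne_zero]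
    exact mul_ne_zero Fintype.card_ne_zero Fintype.card_ne_zero
  exact ((S.smul_mem_iff h5).mp h3).2

/-- The algebra of invariant compact operators on `E` is the algebra of compact operators on the
Hilbert module of invariant vectors over the crossed product. -/
theorem nonempty_starAlgEquiv_compacts (h : T.IsInflated N g)
    (hδ : ∀ y r s, δ.val y r s = g r s) {ρ : W →* R} (hρ : ∀ r : R, ρ r = r)
    (hker : ∀ w, ρ w = 1 ↔ w ∈ N)
    (hip : ∀ ξ η : T.invariants N, ip (e ξ) (e η) = h.crossedIp δ ξ η) :
    Nonempty (T.fixedCompacts ≃⋆ₐ[ℂ] compacts (CrossedProduct δ) F) := by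
  let Φ := h.restrictHom e hip
  have hinj : Function.Injective Φ := h.restrictHom_injective e hip
  let Φₗ : T.fixedCompacts →ₗ[ℂ] Adjointable (CrossedProduct δ) F :=
    { toFun := Φ
      map_add' := map_add Φ
      map_smul' := map_smul Φ }
  -- An injective homomorphism of C⋆-algebras is isometric, so its range is closed; it then suffices
  -- that the range contains the rank-one operators.
  have hclosed : IsClosed (Φₗ.range : Set (Adjointable (CrossedProduct δ) F)) :=
    (NonUnitalStarAlgHom.isometry Φ hinj).isClosedEmbedding.isClosed_range
  have hrange : ∀ l ∈ compacts (CrossedProduct δ) F, ∃ k, Φ k = l := by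
    intro l hl
    refine hclosed.closure_subset_iff.mpr ?_ hl
    refine SetLike.coe_subset_coe.mpr (Submodule.span_le.mpr ?_)
    rintro _ ⟨ξ, η, rfl⟩
    obtain ⟨ξ, rfl⟩ := e.surjective ξ
    obtain ⟨η, rfl⟩ := e.surjective η
    exact ⟨_, h.restrictHom_sumKetbra e hδ hρ hker hip ξ η⟩
  let Ψ := NonUnitalStarAlgHom.codRestrict Φ (compacts (CrossedProduct δ) F)
    (h.restrictHom_mem_compacts e hδ hρ hker hip)
  refine ⟨StarAlgEquiv.ofBijective Ψ ⟨fun k l hkl => hinj (congrArg Subtype.val hkl), ?_⟩⟩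
  rintro ⟨l, hl⟩
  obtain ⟨k, hk⟩ := hrange l hl
  exact ⟨k, Subtype.ext hk⟩

end IsInflated

end TwistedAction

end

/-! ### The Morita equivalence -/

theorem mainTheorem9 {W : Type*} [Group W] [Finite W]
    {X : Type*} [TopologicalSpace X] [LocallyCompactSpace X] [T2Space X]
    [MulAction W X] [ContinuousConstSMul W X] (γ : TwoCocycle W X)
    {E : Type*} [NormedAddCommGroup E] [NormedSpace ℂ E] [HilbertModule C₀(X, ℂ) E]
    (T : TwistedAction γ E)
    (hfiber : ∀ x : X, Nontrivial (Fiber E x))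
    (hcomplete : T.CompletenessCondition)
    (hiota : ∀ (x : X) (w : MulAction.stabilizer W x) (c : ℂ), T.ActsByScalar x w c → c = 1)
    (hconst : ∀ (x y : X) (v w : W), γ.val x v w = γ.val y v w)
    (W' R : Subgroup W) [W'.Normal] (hsemidirect : Subgroup.IsComplement' W' R)
    (x₀ : X) (hfixed : MulAction.stabilizer W x₀ = ⊤)
    (hscalar : ∀ x : X,
      T.scalarStabilizer x = (MulAction.stabilizer W x : Set W) ∩ (W' : Set W)) :
    MoritaEquivalent T.fixedCompacts
      (CrossedProduct (γ.restrictConst hconst x₀ R (OrbitSpace W' X))) := by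
  have h : T.IsInflated W' (γ.val x₀) := T.isInflated hiota hconst W' x₀ hfixed hscalar
  obtain ⟨ρ, hρ, hker⟩ := hsemidirect.exists_retraction
  set δ := γ.restrictConst hconst x₀ R (OrbitSpace W' X) with hδ_def
  have hδ : ∀ y r s, δ.val y r s = γ.val x₀ r s := fun _ _ _ => rfl
  have hscalar' (x : X) (w : MulAction.stabilizer W x) (c : ℂ) (hc : T.ActsByScalar x w c) :
      c = 1 ∧ (w : W) ∈ W' := by
    have hw : (w : W) ∈ T.scalarStabilizer x := ⟨w.2, c, hc⟩
    rw [hscalar] at hw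
    exact ⟨hiota x w c hc, hw.2⟩
  obtain ⟨C, C', hC⟩ := h.exists_norm_crossedIp_bounds (δ := δ)
  -- The lift places the module in the universe that `MoritaEquivalent` prescribes.
  let D := (h.preHilbertModule δ hδ).comap (ULift.moduleEquiv (R := ℂ) (M := T.invariants W'))
  obtain ⟨e, he⟩ := PreHilbertModule.exists_continuousLinearEquiv (D := D)
    (ULift.moduleEquiv (R := ℂ) (M := T.invariants W')).symm C C' (fun ξ => (hC ξ).1)
    (fun ξ => (hC ξ).2)
  have hE : CompleteSpace E := HilbertModule.toCompleteSpace C₀(X, ℂ)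
  have hinv : CompleteSpace (T.invariants W') :=
    (T.isClosed_invariants W').completeSpace_coe
  -- Completeness passes from the closed subspace of invariants through the equivalence of norms.
  have hD : CompleteSpace D.Carrier :=
    (completeSpace_congr (e := e.toEquiv) e.isUniformEmbedding).mp hinv
  have hip (ξ η : T.invariants W') : HilbertModule.ip (e ξ) (e η) = h.crossedIp δ ξ η := by
    rw [he, he]
    rfl
  refine ⟨D.Carrier, inferInstance, inferInstance, inferInstance, ?_,
    h.nonempty_starAlgEquiv_compacts e hδ hρ hker hip⟩
  refine (h.dense_span_crossedIp (δ := δ) hρ hker hcomplete (fun x => hconst x x₀) hfiber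
    hscalar').mono (Submodule.span_mono ?_)
  rintro _ ⟨ξ, η, rfl⟩
  exact ⟨e ξ, e η, (hip ξ η).symm⟩
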